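/- **Setting.** Let $V=\{x\in H^1(0,1):\int_0^1x(\xi)\,d\xi=0\}$ with $\langle x,y\rangle_V=\int_0^1x'y'\,d\xi$, and let $H$ be the dual space of $V$ with the dual norm. For $p\ge 1$ let $\widetilde L^p(0,1)$ be the set of $x\in L^p(0,1)$ with zero mean; it is regarded as a subset of $H$ by identifying $x$ with the functional $y\mapsto\int_0^1x(\xi)y(\xi)\,d\xi$, and in particular $V\subset H$. Let $B:V\to H$, $Bx(y)=\int_0^1x'y'\,d\xi$, and let $A=-B^2$ as an operator in $H$, that is, $D(A)=\{x\in V: Bx\in V\}$. Let $\mu$ be the Gaussian measure on $H$ with mean $0$ and covariance $Q=-\tfrac12A^{-1}=\tfrac12B^{-2}$. For $k\ge 1$ put $f_k(\xi)=k\pi\sqrt2\cos(k\pi\xi)$; the $f_k$ form an orthonormal basis of $H$ and $Qf_k=\lambda_kf_k$ with $\lambda_k=\frac1{2\pi^4k^4}$. Let $P_nx=\sum_{k=1}^n\langle x,f_k\rangle_Hf_k$. Let $\mathcal{FC}^1_b(H)$ be the set of functions $x\mapsto\phi(\langle x,f_1\rangle_H,\dots,\langle x,f_n\rangle_H)$ with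 $n\in\mathbb N$ and $\phi\in C^1_b(\mathbb R^n)$. For $1\le p<\infty$, $W^{1,p}_{1/2}(H,\mu)$ is the domain of the closure $Q^{1/2}D$ in $L^p(H,\mu)$ of the operator $\varphi\mapsto Q^{1/2}D\varphi\in L^p(H,\mu;H)$ defined on $\mathcal{FC}^1_b(H)$, where $D\varphi$ is the gradient of $\varphi$. For $u\in W^{1,p}_{1/2}(H,\mu)$ put $D_ku=\lambda_k^{-1/2}\langle Q^{1/2}Du,f_k\rangle_H$. **Hypothesis.** Let $\Phi:\mathbb R\to\mathbb R$ be convex, of class $C^1$ and bounded from below, and suppose that $|\Phi'(t)|\le C(1+|t|^{p_2})$ for all $t\in\mathbb R$, for some $C>0$ and $p_2\ge1$, and that $\lim_{r\to\pm\infty}\Phi(r)/|r|=+\infty$. Put $p_1=p_2+1$ and $$U(x)=\int_0^1\Phi(x(\xi))\,d\xi\ \text{ if }x\in\widetilde L^{p_1}(0,1),\qquad U(x)=+\infty\ \text{ if }x\in H\setminus\widetilde L^{p_1}(0,1),$$ $$U_n(x)=U(P_nx)=\int_0^1\Phi(P_nx(\xi))\,d\xi,\qquad x\in H,\ n\in\mathbb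 N .$$ **Proposition.** $U$ is finite $\mu$-a.e., and for every $p\in[1,\infty)$ one has $U\in W^{1,p}_{1/2}(H,\mu)$, $U_n\in L^p(H,\mu)$ for all $n$, and $U_n\to U$ in $L^p(H,\mu)$ as $n\to\infty$. Moreover, for every $k\ge1$ and for $\mu$-a.e. $x\in H$, the function $\xi\mapsto\Phi'(x(\xi))f_k(\xi)$ is integrable on $(0,1)$ and $$D_kU(x)=\int_0^1\Phi'(x(\xi))f_k(\xi)\,d\xi .$$ -/

import Mathlib

open MeasureTheory ProbabilityTheory Set Filter Topology
open scoped ENNReal ContDiff InnerProductSpace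

namespace CahnHilliard

noncomputable section

/-! ### The space of mean-zero `H¹` functions on the unit interval -/

/-- Lebesgue measure on the interval `(0, 1)`. -/
abbrev vol01 : Measure ℝ := volume.restrict (Ioo (0 : ℝ) 1)

instance : IsProbabilityMeasure vol01 := ⟨by simp⟩

/-- `v` is the weak derivative of `u` on `(0, 1)`: `∫ u φ' = - ∫ v φ` for every test function
`φ ∈ C_c^∞(0, 1)`. -/
def IsWeakDeriv (u v : ℝ → ℝ) : Prop :=
  ∀ φ : ℝ → ℝ, ContDiff ℝ ∞ φ → HasCompactSupport φ → tsupport φ ⊆ Ioo 0 1 →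
    ∫ ξ, u ξ * deriv φ ξ ∂vol01 = - ∫ ξ, v ξ * φ ξ ∂vol01

/-- The Lebesgue space `L²(0, 1)`. -/
abbrev L2 : Type := Lp ℝ 2 vol01

theorem integrable_mul_test {u φ : ℝ → ℝ} (hu : Integrable u vol01) (hφ : Continuous φ)
    (hc : HasCompactSupport φ) : Integrable (fun ξ => u ξ * φ ξ) vol01 := by
  obtain ⟨C, hC⟩ := hc.exists_bound_of_continuous hφ
  exact hu.mul_bdd (c := C) hφ.aestronglyMeasurable (Eventually.of_forall hC)

theorem integrable_L2 (u : L2) : Integrable u vol01 :=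
  (Lp.memLp u).integrable (by norm_num)

theorem integral_vol01 (f : ℝ → ℝ) : ∫ ξ, f ξ ∂vol01 = ∫ ξ in (0 : ℝ)..1, f ξ := by
  rw [intervalIntegral.integral_of_le zero_le_one, integral_Ioc_eq_integral_Ioo]

theorem intervalIntegrable_of_vol01 {v : ℝ → ℝ} (hv : Integrable v vol01) :
    IntervalIntegrable v volume 0 1 := by
  rw [intervalIntegrable_iff_integrableOn_Ioo_of_le zero_le_one]
  exact hv

/-- The primitive of an integrable function has that function as its weak derivative. -/
theorem isWeakDeriv_primitive {v : ℝ → ℝ} (hv : Integrable v vol01) :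
    IsWeakDeriv (fun x => ∫ t in (0 : ℝ)..x, v t) v := by
  intro φ hφ hc hs
  have hvi := intervalIntegrable_of_vol01 hv
  have hw := hvi.absolutelyContinuousOnInterval_intervalIntegral (c := 0) (by simp)
  have hφa : AbsolutelyContinuousOnInterval φ 0 1 :=
    (hφ.of_le (by simp)).contDiffOn.absolutelyContinuousOnInterval
  have h0 : φ 0 = 0 := image_eq_zero_of_notMem_tsupport (fun h => by simpa using (hs h).1)
  have h1 : φ 1 = 0 := image_eq_zero_of_notMem_tsupport (fun h => by simpa using (hs h).2)
  rw [integral_vol01, integral_vol01, hw.integral_mul_deriv_eq_deriv_mul hφa, h0, h1]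
  simp only [mul_zero, sub_zero, zero_sub, neg_inj]
  apply intervalIntegral.integral_congr_ae
  filter_upwards [hvi.ae_hasDerivAt_integral] with x hx hx'
  rw [(hx (uIoc_subset_uIcc hx') 0 (by simp)).deriv]

/-- An integrable function with zero weak derivative is constant. -/
theorem ae_eq_const_of_weakDeriv_zero {u : ℝ → ℝ} (hu : Integrable u vol01)
    (h : IsWeakDeriv u (fun _ => 0)) : ∃ c : ℝ, u =ᵐ[vol01] fun _ => c := by
  let b : ContDiffBump (1 / 2 : ℝ) := ⟨1 / 8, 1 / 4, by norm_num, by norm_num⟩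
  set η : ℝ → ℝ := b.normed volume with hη
  have hηd : ContDiff ℝ ∞ η := b.contDiff_normed
  have hηc : HasCompactSupport η := b.hasCompactSupport_normed
  have hηs : tsupport η ⊆ Ioo 0 1 := by
    rw [hη, b.tsupport_normed_eq, Real.closedBall_eq_Icc]
    intro x hx
    simp only [b] at hx
    constructor <;> [have := hx.1; have := hx.2] <;> norm_num at this ⊢ <;> linarith
  have hηi : ∫ ξ, η ξ ∂vol01 = 1 := by
    rw [setIntegral_eq_integral_of_forall_compl_eq_zero]
    · exact b.integral_normed
    · intro x hx
      exact image_eq_zero_of_notMem_tsupport (fun h => hx (hηs h))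
  refine ⟨∫ ξ, u ξ * η ξ ∂vol01, ?_⟩
  set c := ∫ ξ, u ξ * η ξ ∂vol01 with hcdef
  have key : ∀ᵐ x ∂(volume : Measure ℝ), x ∈ Ioo (0 : ℝ) 1 → u x - c = 0 := by
    refine isOpen_Ioo.ae_eq_zero_of_integral_contDiff_smul_eq_zero ?_ ?_
    · have : IntegrableOn (fun x => u x - c) (Ioo 0 1) volume := hu.sub (integrable_const c)
      exact this.locallyIntegrableOn
    · intro g hg hgc hgs
      -- the primitive of `g - (∫ g) η` is a test function
      set m := ∫ ξ, g ξ ∂vol01 with hm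
      set q : ℝ → ℝ := fun x => g x - m * η x with hq
      have hqd : ContDiff ℝ ∞ q := hg.sub (contDiff_const.mul hηd)
      have hqz : ∀ x, x ∉ tsupport g ∪ tsupport η → q x = 0 := by
        intro x hx
        simp only [mem_union, not_or] at hx
        simp [hq, image_eq_zero_of_notMem_tsupport hx.1, image_eq_zero_of_notMem_tsupport hx.2]
      have hKc : IsCompact (tsupport g ∪ tsupport η) := hgc.isCompact.union hηc.isCompact
      have hKs : tsupport g ∪ tsupport η ⊆ Ioo (0 : ℝ) 1 := union_subset hgs hηs
      set K := tsupport g ∪ tsupport η with hK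
      obtain ⟨α, hα0, hα1⟩ : ∃ α : ℝ, 0 < α ∧ ∀ x ∈ K, α ≤ x := by
        rcases K.eq_empty_or_nonempty with hE | hE
        · exact ⟨1, one_pos, by simp [hE]⟩
        · obtain ⟨x, hx, hmin⟩ := hKc.exists_isLeast hE
          exact ⟨x, (hKs hx).1, hmin⟩
      obtain ⟨β, hβ0, hβ1⟩ : ∃ β : ℝ, β < 1 ∧ ∀ x ∈ K, x ≤ β := by
        rcases K.eq_empty_or_nonempty with hE | hE
        · exact ⟨0, one_pos, by simp [hE]⟩
        · obtain ⟨x, hx, hmax⟩ := hKc.exists_isGreatest hE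
          exact ⟨x, (hKs hx).2, hmax⟩
      have hqi : ∫ x in (0 : ℝ)..1, q x = 0 := by
        rw [← integral_vol01, hq, integral_sub, integral_const_mul, hηi, mul_one, sub_self]
        · exact (hg.continuous.integrable_of_hasCompactSupport hgc).integrableOn
        · exact ((hηd.continuous.integrable_of_hasCompactSupport hηc).const_mul m).integrableOn
      set ψ : ℝ → ℝ := fun x => ∫ t in (0 : ℝ)..x, q t with hψ
      have hψ' : ∀ x, HasDerivAt ψ (q x) x := fun x =>
        intervalIntegral.integral_hasDerivAt_right (hqd.continuous.intervalIntegrable _ _)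
          hqd.continuous.aestronglyMeasurable.stronglyMeasurableAtFilter hqd.continuous.continuousAt
      have hderiv : deriv ψ = q := funext fun x => (hψ' x).deriv
      have hψd : ContDiff ℝ ∞ ψ := by
        rw [contDiff_infty_iff_deriv]
        exact ⟨fun x => (hψ' x).differentiableAt, hderiv ▸ hqd⟩
      have hψz : ∀ x, x ∉ Icc α β → ψ x = 0 := by
        intro x hx
        rw [mem_Icc, not_and_or, not_le, not_le] at hx
        rcases hx with hx | hx
        · apply intervalIntegral.integral_zero_ae
          refine Eventually.of_forall fun t ht => hqz t fun htK => ?_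
          have := hα1 t htK
          have := ht.2
          have h2 : max 0 x < α := max_lt hα0 hx
          linarith
        · have hsplit : ψ x = (∫ t in (0 : ℝ)..1, q t) - ∫ t in x..1, q t := by
            rw [hψ, eq_sub_iff_add_eq]
            exact intervalIntegral.integral_add_adjacent_intervals
              (hqd.continuous.intervalIntegrable _ _) (hqd.continuous.intervalIntegrable _ _)
          rw [hsplit, hqi, zero_sub, neg_eq_zero]
          apply intervalIntegral.integral_zero_ae
          refine Eventually.of_forall fun t ht => hqz t fun htK => ?_
          have := hβ1 t htK
          have := ht.1
          have h2 : β < min x 1 := lt_min hx hβ0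
          linarith
      have hψsub : tsupport ψ ⊆ Icc α β :=
        closure_minimal (fun x hx => by by_contra hn; exact hx (hψz x hn)) isClosed_Icc
      have hψc : HasCompactSupport ψ := isCompact_Icc.of_isClosed_subset (isClosed_tsupport _) hψsub
      have := h ψ hψd hψc (hψsub.trans fun x hx => ⟨hα0.trans_le hx.1, hx.2.trans_lt hβ0⟩)
      rw [hderiv] at this
      simp only [zero_mul, integral_zero, neg_zero] at this
      have i1 : Integrable (fun ξ => u ξ * g ξ) vol01 := integrable_mul_test hu hg.continuous hgc
      have i2 : Integrable (fun ξ => u ξ * η ξ) vol01 := integrable_mul_test hu hηd.continuous hηc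
      have e1 : ∫ ξ, u ξ * g ξ ∂vol01 = m * c := by
        have : ∫ ξ, u ξ * g ξ - m * (u ξ * η ξ) ∂vol01 = 0 := by
          rw [← this]; congr 1; ext ξ; simp only [hq]; ring
        rw [integral_sub i1 (i2.const_mul m), integral_const_mul] at this
        linarith
      have e2 : ∫ x, g x • (u x - c) = ∫ x, g x • (u x - c) ∂vol01 := by
        rw [setIntegral_eq_integral_of_forall_compl_eq_zero]
        intro x hx
        simp [image_eq_zero_of_notMem_tsupport (fun h => hx (hgs h))]
      rw [e2]
      have e3 : ∫ x, g x • (u x - c) ∂vol01 = ∫ x, u x * g x - c * g x ∂vol01 := by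
        congr 1; ext x; simp only [smul_eq_mul]; ring
      rw [e3, integral_sub i1, integral_const_mul, e1, ← hm]
      · ring
      · exact ((hg.continuous.integrable_of_hasCompactSupport hgc).const_mul c).integrableOn
  filter_upwards [(ae_restrict_iff' measurableSet_Ioo).2 key] with x hx
  linarith

theorem IsWeakDeriv.congr {u u' v v' : ℝ → ℝ} (h : IsWeakDeriv u v) (hu : u =ᵐ[vol01] u')
    (hv : v =ᵐ[vol01] v') : IsWeakDeriv u' v' := by
  intro φ h1 h2 h3
  have e1 : ∫ ξ, u ξ * deriv φ ξ ∂vol01 = ∫ ξ, u' ξ * deriv φ ξ ∂vol01 :=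
    integral_congr_ae (hu.mul (EventuallyEq.refl _ (deriv φ)))
  have e2 : ∫ ξ, v ξ * φ ξ ∂vol01 = ∫ ξ, v' ξ * φ ξ ∂vol01 :=
    integral_congr_ae (hv.mul (EventuallyEq.refl _ φ))
  rw [← e1, ← e2]
  exact h φ h1 h2 h3

theorem IsWeakDeriv.add {u u' v v' : ℝ → ℝ} (h : IsWeakDeriv u v) (h' : IsWeakDeriv u' v')
    (hu : Integrable u vol01) (hu' : Integrable u' vol01) (hv : Integrable v vol01)
    (hv' : Integrable v' vol01) : IsWeakDeriv (u + u') (v + v') := by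
  intro φ h1 h2 h3
  have hd : Continuous (deriv φ) := h1.continuous_deriv (by simp)
  simp only [Pi.add_apply, add_mul]
  rw [integral_add (integrable_mul_test hu hd h2.deriv) (integrable_mul_test hu' hd h2.deriv),
    integral_add (integrable_mul_test hv h1.continuous h2)
      (integrable_mul_test hv' h1.continuous h2), h φ h1 h2 h3, h' φ h1 h2 h3]
  ring

theorem IsWeakDeriv.smul {u v : ℝ → ℝ} (c : ℝ) (h : IsWeakDeriv u v) :
    IsWeakDeriv (c • u) (c • v) := by
  intro φ h1 h2 h3
  simp only [Pi.smul_apply, smul_eq_mul, mul_assoc]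
  rw [integral_const_mul, integral_const_mul, h φ h1 h2 h3]
  ring

theorem isWeakDeriv_const (c : ℝ) : IsWeakDeriv (fun _ => c) (fun _ => 0) := by
  intro φ h1 h2 h3
  have := isWeakDeriv_primitive (v := φ)
    ((h1.continuous.integrable_of_hasCompactSupport h2).integrableOn)
  have h0 : φ 0 = 0 := image_eq_zero_of_notMem_tsupport (fun h => by simpa using (h3 h).1)
  have h1' : φ 1 = 0 := image_eq_zero_of_notMem_tsupport (fun h => by simpa using (h3 h).2)
  rw [integral_const_mul, integral_vol01 (deriv φ), intervalIntegral.integral_deriv_eq_sub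
    (fun x _ => (h1.differentiable (by simp)).differentiableAt)
    ((h1.continuous_deriv (by simp)).intervalIntegrable _ _), h0, h1']
  simp

theorem integrable_primitive {v : ℝ → ℝ} (hv : Integrable v vol01) :
    Integrable (fun x => ∫ t in (0 : ℝ)..x, v t) vol01 := by
  have := intervalIntegral.continuousOn_primitive_interval (a := 0) (b := 1) (f := v)
    (μ := volume) ?_
  · rw [uIcc_of_le zero_le_one] at this
    exact (this.integrableOn_Icc).mono_set Ioo_subset_Icc_self
  · rw [uIcc_of_le zero_le_one, integrableOn_Icc_iff_integrableOn_Ioo]; exact hv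

/-- A function with an integrable weak derivative is a.e. a constant plus a primitive. -/
theorem IsWeakDeriv.exists_eq_primitive {u v : ℝ → ℝ} (h : IsWeakDeriv u v)
    (hu : Integrable u vol01) (hv : Integrable v vol01) :
    ∃ c : ℝ, u =ᵐ[vol01] fun x => c + ∫ t in (0 : ℝ)..x, v t := by
  have h1 := h.add ((isWeakDeriv_primitive hv).smul (-1)) hu ((integrable_primitive hv).smul (-1))
    hv (hv.smul (-1))
  obtain ⟨c, hc⟩ := ae_eq_const_of_weakDeriv_zero (hu.add ((integrable_primitive hv).smul (-1)))
    (h1.congr (EventuallyEq.refl _ _) (Eventually.of_forall fun x => by simp))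
  refine ⟨c, ?_⟩
  filter_upwards [hc] with x hx
  simp only [Pi.add_apply, Pi.smul_apply, smul_eq_mul] at hx
  linarith

/-- The mean-zero functions of `H¹(0, 1)`, as pairs `(x, x')` of a function and its
weak derivative. -/
def meanZeroH1 : Submodule ℝ (L2 × L2) where
  carrier := {p | IsWeakDeriv p.1 p.2 ∧ ∫ ξ, p.1 ξ ∂vol01 = 0}
  zero_mem' := by
    refine ⟨(isWeakDeriv_const 0).congr ?_ ?_, ?_⟩
    · exact (Lp.coeFn_zero ℝ 2 vol01).symm
    · exact (Lp.coeFn_zero ℝ 2 vol01).symm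
    · simp
  add_mem' := by
    rintro p q ⟨hp, hp'⟩ ⟨hq, hq'⟩
    refine ⟨(hp.add hq (integrable_L2 _) (integrable_L2 _) (integrable_L2 _)
      (integrable_L2 _)).congr (Lp.coeFn_add _ _).symm (Lp.coeFn_add _ _).symm, ?_⟩
    rw [Prod.fst_add, integral_congr_ae (Lp.coeFn_add _ _)]
    simp only [Pi.add_apply]
    rw [integral_add (integrable_L2 _) (integrable_L2 _), hp', hq', add_zero]
  smul_mem' := by
    rintro c p ⟨hp, hp'⟩
    refine ⟨(hp.smul c).congr (Lp.coeFn_smul _ _).symm (Lp.coeFn_smul _ _).symm, ?_⟩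
    rw [Prod.smul_fst, integral_congr_ae (Lp.coeFn_smul _ _)]
    simp only [Pi.smul_apply, smul_eq_mul]
    rw [integral_const_mul, hp', mul_zero]

/-- The space `V` of mean-zero functions in `H¹(0, 1)`; it carries the inner product
`⟨x, y⟩_V = ∫ x' y'`. -/
def V : Type := meanZeroH1

instance : AddCommGroup V := inferInstanceAs (AddCommGroup meanZeroH1)

instance : Module ℝ V := inferInstanceAs (Module ℝ meanZeroH1)

/-- The element of `L²(0, 1)` underlying an element of `V`. -/
def V.fn : V →ₗ[ℝ] L2 := (LinearMap.fst ℝ L2 L2).comp meanZeroH1.subtype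

/-- The weak derivative of an element of `V`. -/
def V.dn : V →ₗ[ℝ] L2 := (LinearMap.snd ℝ L2 L2).comp meanZeroH1.subtype

theorem V.isWeakDeriv (x : V) : IsWeakDeriv (V.fn x) (V.dn x) := x.2.1

theorem V.integral_eq_zero (x : V) : ∫ ξ, V.fn x ξ ∂vol01 = 0 := x.2.2

theorem V.ext {x y : V} (h : V.fn x = V.fn y) (h' : V.dn x = V.dn y) : x = y :=
  Subtype.ext (Prod.ext h h')

theorem norm_primitive_le (v : L2) {x : ℝ} (hx : x ∈ Ioo (0 : ℝ) 1) :
    ‖∫ t in (0 : ℝ)..x, v t‖ ≤ ‖v‖ := by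
  have h1 : ‖∫ t in (0 : ℝ)..x, v t‖ ≤ ∫ t, ‖v t‖ ∂vol01 := by
    refine (intervalIntegral.norm_integral_le_integral_norm hx.1.le).trans ?_
    rw [intervalIntegral.integral_of_le hx.1.le]
    exact setIntegral_mono_set (integrable_L2 v).norm
      (Eventually.of_forall fun t => norm_nonneg _)
      (LE.le.eventuallyLE (show Ioc 0 x ≤ Ioo 0 1 from fun t ht => ⟨ht.1, ht.2.trans_lt hx.2⟩))
  refine h1.trans ?_
  rw [integral_norm_eq_lintegral_enorm (integrable_L2 v).aestronglyMeasurable,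
    ← eLpNorm_one_eq_lintegral_enorm, Lp.norm_def]
  refine ENNReal.toReal_mono (Lp.eLpNorm_ne_top v) ?_
  exact eLpNorm_le_eLpNorm_of_exponent_le (by norm_num) (Lp.aestronglyMeasurable v)

/-- The Poincaré inequality on `V`. -/
theorem V.norm_fn_le (x : V) : ‖V.fn x‖ ≤ 2 * ‖V.dn x‖ := by
  obtain ⟨c, hc⟩ := (V.isWeakDeriv x).exists_eq_primitive (integrable_L2 _) (integrable_L2 _)
  have hp := integrable_primitive (integrable_L2 (V.dn x))
  have hw : ∀ᵐ ξ ∂vol01, ‖∫ t in (0 : ℝ)..ξ, V.dn x t‖ ≤ ‖V.dn x‖ :=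
    (ae_restrict_iff' measurableSet_Ioo).2
      (Eventually.of_forall fun ξ hξ => norm_primitive_le (V.dn x) hξ)
  have hcn : ‖c‖ ≤ ‖V.dn x‖ := by
    have h0 := V.integral_eq_zero x
    rw [integral_congr_ae hc, integral_add (integrable_const c) hp] at h0
    simp only [integral_const, probReal_univ, one_smul] at h0
    rw [eq_neg_of_add_eq_zero_left h0, norm_neg]
    simpa using norm_integral_le_of_norm_le_const hw
  refine Lp.norm_le_of_ae_bound (by positivity) ?_ |>.trans (b := (vol01.real univ) ^
    ((2 : ℝ≥0∞).toReal)⁻¹ * (2 * ‖V.dn x‖)) (by simp)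
  filter_upwards [hc, hw] with ξ h1 h2
  rw [h1]
  exact (norm_add_le _ _).trans (by linarith)

/-- The inner product `⟨x, y⟩_V = ∫ x' y'` on `V`. -/
@[reducible] def V.core : InnerProductSpace.Core ℝ V where
  inner x y := inner ℝ (V.dn x) (V.dn y)
  conj_inner_symm x y := by simp [real_inner_comm]
  re_inner_nonneg x := by simp
  add_left x y z := by simp [inner_add_left]
  smul_left x y r := by simp [inner_smul_left]
  definite x h := by
    have hd : V.dn x = 0 := inner_self_eq_zero.1 h
    have hf : V.fn x = 0 := by
      have := V.norm_fn_le x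
      rw [hd, norm_zero, mul_zero] at this
      exact norm_le_zero_iff.1 this
    exact V.ext (hf.trans (map_zero _).symm) (hd.trans (map_zero _).symm)

instance : NormedAddCommGroup V := V.core.toNormedAddCommGroup

instance : InnerProductSpace ℝ V := InnerProductSpace.ofCore V.core.toCore

theorem V.inner_def (x y : V) : inner ℝ x y = ∫ ξ, V.dn x ξ * V.dn y ξ ∂vol01 := by
  change inner ℝ (V.dn x) (V.dn y) = _
  rw [L2.inner_def]
  simp [mul_comm]

theorem V.norm_dn (x : V) : ‖V.dn x‖ = ‖x‖ := by
  rw [@norm_eq_sqrt_real_inner _ _ _ (V.dn x), @norm_eq_sqrt_real_inner _ _ _ x]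
  rfl

theorem V.dn_surjective : Function.Surjective V.dn := by
  intro v
  have hv := integrable_L2 v
  set w : ℝ → ℝ := fun x => ∫ t in (0 : ℝ)..x, v t with hw
  have hwi : Integrable w vol01 := integrable_primitive hv
  set c : ℝ := - ∫ ξ, w ξ ∂vol01 with hc
  have hwd : IsWeakDeriv (w + fun _ => c) ((v : ℝ → ℝ) + fun _ => 0) :=
    (isWeakDeriv_primitive hv).add (isWeakDeriv_const c) hwi (integrable_const c) hv
      (integrable_const 0)
  have hm : MemLp (w + fun _ => c) 2 vol01 := by
    refine MemLp.of_bound (hwi.add (integrable_const c)).aestronglyMeasurable (‖v‖ + ‖c‖) ?_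
    refine (ae_restrict_iff' measurableSet_Ioo).2 (Eventually.of_forall fun ξ hξ => ?_)
    exact (norm_add_le _ _).trans (add_le_add_left (norm_primitive_le v hξ) _)
  refine ⟨⟨(hm.toLp, v), hwd.congr hm.coeFn_toLp.symm
    (Eventually.of_forall fun ξ => add_zero (v ξ)), ?_⟩, rfl⟩
  rw [integral_congr_ae hm.coeFn_toLp]
  simp only [Pi.add_apply]
  rw [integral_add hwi (integrable_const c)]
  simp [hc]

instance : CompleteSpace V := by
  let e : V ≃ₗᵢ[ℝ] L2 := LinearIsometryEquiv.ofSurjective ⟨V.dn, V.norm_dn⟩ V.dn_surjective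
  exact (completeSpace_congr (e := e.toEquiv) e.isometry.isUniformEmbedding).2 inferInstance

/-! ### The dual space `H` -/

/-- `H` is the dual space of `V`, with the dual norm. -/
def H : Type := StrongDual ℝ V

instance : NormedAddCommGroup H := inferInstanceAs (NormedAddCommGroup (StrongDual ℝ V))

instance : NormedSpace ℝ H := inferInstanceAs (NormedSpace ℝ (StrongDual ℝ V))

instance : CompleteSpace H := inferInstanceAs (CompleteSpace (StrongDual ℝ V))

instance : FunLike H V ℝ := inferInstanceAs (FunLike (StrongDual ℝ V) V ℝ)

instance : MeasurableSpace H := borel H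

instance : BorelSpace H := ⟨rfl⟩

/-- The map `B : V → H`, `Bx(y) = ∫ x' y' = ⟨x, y⟩_V`, as an isometric isomorphism. -/
def B : V ≃ₗᵢ[ℝ] H where
  toFun x := InnerProductSpace.toDual ℝ V x
  invFun x := (InnerProductSpace.toDual ℝ V).symm x
  left_inv x := (InnerProductSpace.toDual ℝ V).symm_apply_apply x
  right_inv x := (InnerProductSpace.toDual ℝ V).apply_symm_apply x
  map_add' x y := map_add (InnerProductSpace.toDual ℝ V) x y
  map_smul' c x := map_smulₛₗ (InnerProductSpace.toDual ℝ V) c x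
  norm_map' x := (InnerProductSpace.toDual ℝ V).norm_map x

theorem B_apply (x y : V) : B x y = ∫ ξ, V.dn x ξ * V.dn y ξ ∂vol01 := V.inner_def x y

/-- The inner product of `H` that induces the dual norm. -/
instance : InnerProductSpace ℝ H where
  toNormedSpace := inferInstance
  inner x y := inner ℝ (B.symm x) (B.symm y)
  norm_sq_eq_re_inner x := by
    rw [← B.symm.norm_map x]; exact norm_sq_eq_re_inner (𝕜 := ℝ) (B.symm x)
  conj_inner_symm x y := by simp [real_inner_comm]
  add_left x y z := by simp [inner_add_left]
  smul_left x y r := by simp [inner_smul_left]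

theorem H.inner_def (x y : H) : inner ℝ x y = x (B.symm y) := by
  obtain ⟨u, rfl⟩ := B.surjective x
  change inner ℝ (B.symm (B u)) (B.symm y) = _
  rw [B.symm_apply_apply]
  rfl

/-- The inclusion of `V` into `L²(0, 1)`. -/
def V.toL2 : V →L[ℝ] L2 :=
  V.fn.mkContinuous 2 fun x => by rw [← V.norm_dn]; exact V.norm_fn_le x

/-- The map `L²(0, 1) → H` sending `g` to the functional `y ↦ ∫ g y`. On mean-zero functions it is
the identification of functions with elements of `H`. -/
def ofL2 : L2 →L[ℝ] H :=
  (((ContinuousLinearMap.compL ℝ V L2 ℝ).flip V.toL2).comp (innerSL ℝ) :)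

theorem ofL2_apply (g : L2) (y : V) : ofL2 g y = ∫ ξ, g ξ * V.fn y ξ ∂vol01 := by
  change inner ℝ g (V.fn y) = _
  rw [L2.inner_def]
  simp [mul_comm]

/-- The inclusion of `V` into `H`. -/
def ι : V →L[ℝ] H := ofL2.comp V.toL2

/-- The inverse of `B`, regarded as an unbounded operator in `H` with domain `V`. -/
def Binv : H →L[ℝ] H := ι.comp (B.symm.toContinuousLinearEquiv : H →L[ℝ] V)

/-- The covariance operator `Q = - A⁻¹ / 2`, where `A = - B²`; that is, `Q = B⁻² / 2`. -/
def Q : H →L[ℝ] H := (1 / 2 : ℝ) • Binv.comp Binv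

/-- `Q = - A⁻¹ / 2`: each `Qx` lies in `D(A) = {u ∈ V : Bu ∈ V}`, and
`A (Qx) = - B (B (Qx)) = - x / 2`. -/
theorem Q_spec (x : H) : ∃ u v : V, Q x = ι u ∧ B u = ι v ∧ -(B v) = -(1 / 2 : ℝ) • x := by
  refine ⟨(1 / 2 : ℝ) • B.symm (ι (B.symm x)), (1 / 2 : ℝ) • B.symm x, ?_, ?_, ?_⟩
  · rw [map_smul]; rfl
  · rw [map_smul, map_smul, B.apply_symm_apply]
  · rw [map_smul, B.apply_symm_apply]; simp

/-- The positive square root `Q^{1/2} = B⁻¹ / √2` of `Q`. -/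
def Qhalf : H →L[ℝ] H := (√2)⁻¹ • Binv

theorem Qhalf_comp_Qhalf : Qhalf.comp Qhalf = Q := by
  ext1 x
  have : (√2)⁻¹ * (√2)⁻¹ = (1 / 2 : ℝ) := by
    rw [← mul_inv, Real.mul_self_sqrt (by norm_num)]; norm_num
  simp only [Qhalf, Q, ContinuousLinearMap.comp_apply, _root_.smul_apply, map_smul,
    smul_smul, this]

theorem inner_Binv (x y : H) :
    inner ℝ (Binv x) y = inner ℝ (V.toL2 (B.symm x)) (V.toL2 (B.symm y)) := by
  rw [H.inner_def]; rfl

theorem Qhalf_isPositive : Qhalf.IsPositive := by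
  have h : ∀ x y : H, inner ℝ (Qhalf x) y = (√2)⁻¹ * inner ℝ (V.toL2 (B.symm x))
      (V.toL2 (B.symm y)) := by
    intro x y
    rw [← inner_Binv, Qhalf, _root_.smul_apply, real_inner_smul_left]
  refine ⟨fun x y => ?_, fun x => ?_⟩
  · change inner ℝ (Qhalf x) y = inner ℝ x (Qhalf y)
    rw [h, real_inner_comm (Qhalf y) x, h, real_inner_comm]
  · rw [ContinuousLinearMap.reApplyInnerSelf_apply, h]
    exact mul_nonneg (by positivity) real_inner_self_nonneg

/-- The function `f_k(ξ) = k π e_k(ξ) = √2 k π cos(k π ξ)`. -/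
def fFun (k : ℕ) (ξ : ℝ) : ℝ := k * Real.pi * (√2 * Real.cos (k * Real.pi * ξ))

theorem memLp_fFun (k : ℕ) : MemLp (fFun k) 2 vol01 := by
  have hc : Continuous (fFun k) := by unfold fFun; fun_prop
  refine MemLp.of_bound hc.aestronglyMeasurable (|k * Real.pi| * |√2|)
    (Eventually.of_forall fun ξ => ?_)
  rw [fFun, Real.norm_eq_abs, abs_mul, abs_mul (√2)]
  exact mul_le_mul_of_nonneg_left
    (mul_le_of_le_one_right (abs_nonneg _) (Real.abs_cos_le_one _)) (abs_nonneg _)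

/-- The orthonormal basis `f_1, f_2, …` of `H`. (The value at `k = 0` is irrelevant.) -/
def f (k : ℕ) : H := ofL2 (memLp_fFun k).toLp

/-- The eigenvalues `λ_k = 1 / (2 π⁴ k⁴)` of `Q`: `Q f_k = λ_k f_k` for `k ≥ 1`. -/
def eig (k : ℕ) : ℝ := 1 / (2 * Real.pi ^ 4 * (k : ℝ) ^ 4)

/-- The orthogonal projection `P_n` on the span of `f_1, …, f_n`. -/
def P (n : ℕ) (x : H) : H := ∑ k ∈ Finset.Icc 1 n, inner ℝ x (f k) • f k

/-- `g ∈ L̃^p(0, 1)` (the mean-zero functions in `L^p(0, 1)`) is identified with `x ∈ H`, that is,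
`x(y) = ∫ g y` for all `y ∈ V`. -/
def Represents (p : ℝ≥0∞) (g : ℝ → ℝ) (x : H) : Prop :=
  MemLp g p vol01 ∧ ∫ ξ, g ξ ∂vol01 = 0 ∧ ∀ y : V, x y = ∫ ξ, g ξ * V.fn y ξ ∂vol01

/-- The subset `L̃^p(0, 1)` of `H`. -/
def LTilde (p : ℝ≥0∞) : Set H := {x | ∃ g, Represents p g x}

open Classical in
/-- The function `ξ ↦ x(ξ)` identified with `x`, for `x ∈ L̃¹(0, 1)` (unique up to a.e. equality);
zero for the other `x ∈ H`. -/
def toFun (x : H) : ℝ → ℝ := if h : ∃ g, Represents 1 g x then h.choose else 0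

/-! ### Gaussian measures and Sobolev spaces -/

section Sobolev

variable {E : Type*} [NormedAddCommGroup E] [InnerProductSpace ℝ E] [MeasurableSpace E]

/-- `μ` is the Gaussian measure `N_{0, R}` with mean `0` and covariance operator `R`. -/
structure IsCenteredGaussian (R : E →L[ℝ] E) (μ : Measure E) : Prop where
  isGaussian : IsGaussian μ
  mean : ∀ y : E, ∫ x, inner ℝ x y ∂μ = 0
  cov : ∀ y z : E, ∫ x, inner ℝ x y * inner ℝ x z ∂μ = inner ℝ (R y) z

/-- The class `FC¹_b` of cylindrical functions `x ↦ ϕ(x_1, …, x_n)`, where `x_k = ⟨x, b_k⟩` and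
`ϕ` is a `C¹` function on `ℝⁿ`, bounded with bounded derivative. -/
def IsCylindrical (b : ℕ → E) (φ : E → ℝ) : Prop :=
  ∃ (n : ℕ) (ϕ : (Fin n → ℝ) → ℝ), ContDiff ℝ 1 ϕ ∧ (∃ C : ℝ, ∀ y, |ϕ y| ≤ C) ∧
    (∃ C : ℝ, ∀ y, ‖fderiv ℝ ϕ y‖ ≤ C) ∧ φ = fun x => ϕ fun i => inner ℝ x (b (i + 1))

/-- `(u, G)` belongs to the closure in `L^p(E, μ) × L^p(E, μ; E)` of the graph of the operator
`φ ↦ S Dφ` defined on `FC¹_b`. With `S = R^{1/2}`, where `R` is the covariance operator of `μ`,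
this says that `u` belongs to `W^{1,p}_{1/2}(E, μ)` and that `G = R^{1/2} Du`. -/
structure HasSobolevGrad [CompleteSpace E] (μ : Measure E) (b : ℕ → E) (S : E →L[ℝ] E) (p : ℝ≥0∞)
    (u : E → ℝ) (G : E → E) : Prop where
  memLp : MemLp u p μ
  memLp_grad : MemLp G p μ
  approx : ∃ φ : ℕ → E → ℝ, (∀ m, IsCylindrical b (φ m)) ∧
    Tendsto (fun m => eLpNorm (fun x => φ m x - u x) p μ) atTop (𝓝 0) ∧
    Tendsto (fun m => eLpNorm (fun x => S (gradient (φ m) x) - G x) p μ) atTop (𝓝 0)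

end Sobolev

/-- `u` belongs to the space `W^{1,p}_{1/2}(H, μ)`. -/
def MemW (μ : Measure H) (p : ℝ≥0∞) (u : H → ℝ) : Prop :=
  ∃ G : H → H, HasSobolevGrad μ f Qhalf p u G

/-- `D : H → ℝ` is the `k`-th partial derivative `D_k u = λ_k^{-1/2} ⟨Q^{1/2} Du, f_k⟩` of
`u ∈ W^{1,p}_{1/2}(H, μ)` (for every version of `Q^{1/2} Du`). -/
def IsPartialDeriv (μ : Measure H) (p : ℝ≥0∞) (u : H → ℝ) (k : ℕ) (D : H → ℝ) : Prop :=
  MemW μ p u ∧ ∀ G : H → H, HasSobolevGrad μ f Qhalf p u G →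
    ∀ᵐ x ∂μ, D x = (√(eig k))⁻¹ * inner ℝ (G x) (f k)

/-! ### The potential -/

/-- The assumptions on `Φ`: it is `C¹`, convex and bounded from below, `Φ'` has polynomial growth
of order `p₂ ≥ 1`, and `Φ(r) / |r| → +∞` as `r → ±∞`. -/
structure IsPotential (Φ : ℝ → ℝ) (C p₂ : ℝ) : Prop where
  contDiff : ContDiff ℝ 1 Φ
  convex : ConvexOn ℝ univ Φ
  bddBelow : BddBelow (range Φ)
  C_pos : 0 < C
  one_le : 1 ≤ p₂
  growth : ∀ t : ℝ, |deriv Φ t| ≤ C * (1 + |t| ^ p₂)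
  tendsto_atTop : Tendsto (fun r => Φ r / |r|) atTop atTop
  tendsto_atBot : Tendsto (fun r => Φ r / |r|) atBot atTop

open Classical in
/-- `U(x) = ∫ Φ(x(ξ)) dξ` if `x ∈ L̃^{p₁}(0, 1)`, where `p₁ = p₂ + 1`, and `U(x) = +∞` otherwise. -/
def U (Φ : ℝ → ℝ) (p₂ : ℝ) (x : H) : EReal :=
  if x ∈ LTilde (ENNReal.ofReal (p₂ + 1)) then ((∫ ξ, Φ (toFun x ξ) ∂vol01 : ℝ) : EReal) else ⊤

/-- `U_n(x) = ∫ Φ(P_n x(ξ)) dξ`, where `P_n x(ξ) = ∑_{k ≤ n} ⟨x, f_k⟩ f_k(ξ)`. -/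
def Un (Φ : ℝ → ℝ) (n : ℕ) (x : H) : ℝ :=
  ∫ ξ, Φ (∑ k ∈ Finset.Icc 1 n, inner ℝ x (f k) * fFun k ξ) ∂vol01

end

end CahnHilliard

/-!
The series `∑ ⟨x, f_k⟩ f_k(ξ)` converges in `L^q(μ × dξ)` for every finite `q`: at fixed `ξ` its
partial sums `P_n x(ξ)` are centered Gaussian, and `λ_k f_k(ξ)² ≤ k⁻²` controls their increments
uniformly in `ξ`. Its sum is a version of `(x, ξ) ↦ x(ξ)`. Since `Φ` and `Φ'` have polynomial
growth, the bounds on all moments give `Φ(P_n x(ξ)) → Φ(x(ξ))` and `Φ'(P_n x(ξ)) → Φ'(x(ξ))` in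
every `L^q` by uniform integrability. If `Φ` is composed with a smooth truncation, `U_n` is a
cylindrical function of class `C¹_b` with `Q^{1/2} DU_n(x) = P_n (2^{-1/2} Φ'(P_n x))`, so that
removing the truncation as `n → ∞` exhibits `(U, 2^{-1/2} Φ'(x))` as an element of the closure. That
`Q^{1/2} DU` does not depend on the approximating sequence follows from Gaussian integration by
parts in the direction `f_k`.
-/

namespace CahnHilliard

open scoped Real

/-! ### Cosines on the unit interval -/

theorem exists_ae_norm_le_of_continuous {g : ℝ → ℝ} (hg : Continuous g) :
    ∃ C, ∀ᵐ ξ ∂vol01, ‖g ξ‖ ≤ C := by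
  obtain ⟨C, hC⟩ := isCompact_Icc.exists_bound_of_continuousOn (s := Icc (0 : ℝ) 1) hg.continuousOn
  exact ⟨C, ae_restrict_of_forall_mem measurableSet_Ioo fun ξ hξ => hC ξ (Ioo_subset_Icc_self hξ)⟩

theorem integral_mul_congr_left {α : Type*} {_ : MeasurableSpace α} {ν : Measure α}
    {u v : α → ℝ} (h : u =ᵐ[ν] v) (w : α → ℝ) : ∫ a, u a * w a ∂ν = ∫ a, v a * w a ∂ν :=
  integral_congr_ae (h.mul (EventuallyEq.refl _ w))

theorem integrable_mul_continuous {v g : ℝ → ℝ} (hv : Integrable v vol01) (hg : Continuous g) :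
    Integrable (fun ξ => v ξ * g ξ) vol01 := by
  obtain ⟨C, hC⟩ := exists_ae_norm_le_of_continuous hg
  exact hv.mul_bdd hg.aestronglyMeasurable hC

theorem memLp_of_continuous {g : ℝ → ℝ} (hg : Continuous g) (p : ℝ≥0∞) : MemLp g p vol01 := by
  obtain ⟨C, hC⟩ := exists_ae_norm_le_of_continuous hg
  exact MemLp.of_bound hg.aestronglyMeasurable C hC

theorem integrable_of_continuous {g : ℝ → ℝ} (hg : Continuous g) : Integrable g vol01 :=
  memLp_one_iff_integrable.1 (memLp_of_continuous hg 1)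

theorem ae_eq_zero_of_integral_mul_test_eq_zero {v : ℝ → ℝ} (hv : Integrable v vol01)
    (h : ∀ φ : ℝ → ℝ, ContDiff ℝ ∞ φ → HasCompactSupport φ → tsupport φ ⊆ Ioo 0 1 →
      ∫ ξ, v ξ * φ ξ ∂vol01 = 0) : v =ᵐ[vol01] 0 := by
  have hv' : IntegrableOn v (Ioo 0 1) volume := hv
  refine (ae_restrict_iff' measurableSet_Ioo).2
    (isOpen_Ioo.ae_eq_zero_of_integral_contDiff_smul_eq_zero hv'.locallyIntegrableOn ?_)
  intro g hg hc hs
  rw [← h g hg hc hs, setIntegral_eq_integral_of_forall_compl_eq_zero]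
  · simp only [smul_eq_mul, mul_comm]
  · intro x hx
    simp [image_eq_zero_of_notMem_tsupport fun h => hx (hs h)]

theorem integral_mul_cos_pow_mul_cos {v : ℝ → ℝ} (hv : Integrable v vol01)
    (h : ∀ k : ℕ, ∫ ξ, v ξ * Real.cos (k * π * ξ) ∂vol01 = 0) (n : ℕ) (k : ℤ) :
    ∫ ξ, v ξ * (Real.cos (π * ξ) ^ n * Real.cos (k * π * ξ)) ∂vol01 = 0 := by
  induction n generalizing k with
  | zero =>
    obtain ⟨m, rfl | rfl⟩ := k.eq_nat_or_neg
    · simpa using h m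
    · simpa [neg_mul, Real.cos_neg] using h m
  | succ n ih =>
    have product_to_sum (ξ : ℝ) :
        v ξ * (Real.cos (π * ξ) ^ (n + 1) * Real.cos (k * π * ξ)) =
          v ξ * (Real.cos (π * ξ) ^ n * Real.cos ((k - 1 : ℤ) * π * ξ)) / 2 +
            v ξ * (Real.cos (π * ξ) ^ n * Real.cos ((k + 1 : ℤ) * π * ξ)) / 2 := by
      have := Real.two_mul_cos_mul_cos (k * π * ξ) (π * ξ)
      push_cast
      rw [sub_mul, sub_mul, add_mul, add_mul, one_mul]
      linear_combination v ξ * Real.cos (π * ξ) ^ n / 2 * this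
    have integrable (j : ℤ) := integrable_mul_continuous hv
      (g := fun ξ => Real.cos (π * ξ) ^ n * Real.cos (j * π * ξ)) (by fun_prop)
    simp_rw [product_to_sum]
    rw [integral_add ((integrable _).div_const _) ((integrable _).div_const _), integral_div,
      integral_div, ih, ih, zero_div, add_zero]

theorem integral_mul_eval_cos {v : ℝ → ℝ} (hv : Integrable v vol01)
    (h : ∀ k : ℕ, ∫ ξ, v ξ * Real.cos (k * π * ξ) ∂vol01 = 0) (p : Polynomial ℝ) :
    ∫ ξ, v ξ * p.eval (Real.cos (π * ξ)) ∂vol01 = 0 := by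
  simp_rw [Polynomial.eval_eq_sum_range, Finset.mul_sum, mul_left_comm (v _)]
  rw [integral_finsetSum _ fun n _ => (integrable_mul_continuous hv (by fun_prop)).const_mul _]
  refine Finset.sum_eq_zero fun n _ => ?_
  have := integral_mul_cos_pow_mul_cos hv h n 0
  simp only [Int.cast_zero, zero_mul, Real.cos_zero, mul_one] at this
  rw [integral_const_mul, this, mul_zero]

theorem ae_eq_zero_of_integral_mul_cos_eq_zero {v : ℝ → ℝ} (hv : Integrable v vol01)
    (h : ∀ k : ℕ, ∫ ξ, v ξ * Real.cos (k * π * ξ) ∂vol01 = 0) : v =ᵐ[vol01] 0 := by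
  refine ae_eq_zero_of_integral_mul_test_eq_zero hv fun φ hφ _ _ => ?_
  have hφc := hφ.continuous
  have norm_le (ε : ℝ) (hε : 0 < ε) :
      ‖∫ ξ, v ξ * φ ξ ∂vol01‖ ≤ ε * ∫ ξ, ‖v ξ‖ ∂vol01 := by
    obtain ⟨p, hp⟩ := exists_polynomial_near_of_continuousOn (-1) 1
      (fun t => φ (Real.arccos t / π)) (by fun_prop) ε hε
    rw [← sub_zero (∫ ξ, v ξ * φ ξ ∂vol01), ← integral_mul_eval_cos hv h p,
      ← integral_sub (integrable_mul_continuous hv hφc)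
        (integrable_mul_continuous hv (by fun_prop)), ← integral_const_mul]
    refine norm_integral_le_of_norm_le (hv.norm.const_mul ε) ?_
    refine ae_restrict_of_forall_mem measurableSet_Ioo fun ξ hξ => ?_
    have near := hp (Real.cos (π * ξ)) ⟨Real.neg_one_le_cos _, Real.cos_le_one _⟩
    rw [Real.arccos_cos (by nlinarith [hξ.1, Real.pi_pos]) (by nlinarith [hξ.2, Real.pi_pos]),
      mul_div_cancel_left₀ _ Real.pi_ne_zero, abs_sub_comm] at near
    rw [← mul_sub, norm_mul, mul_comm]
    exact mul_le_mul_of_nonneg_right near.le (norm_nonneg _)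
  rw [← norm_le_zero_iff]
  refine ge_of_tendsto ?_ (eventually_mem_nhdsWithin.mono norm_le : ∀ᶠ ε in 𝓝[>] (0 : ℝ), _)
  exact ((continuous_mul_const _).tendsto' 0 0 (zero_mul _)).mono_left nhdsWithin_le_nhds

theorem contDiff_fFun (k : ℕ) {n : WithTop ℕ∞} : ContDiff ℝ n (fFun k) := by
  unfold fFun; fun_prop

theorem continuous_fFun (k : ℕ) : Continuous (fFun k) := (contDiff_fFun k (n := 0)).continuous

theorem deriv_fFun (k : ℕ) :
    deriv (fFun k) = fun ξ => -((k * π) ^ 2 * √2) * Real.sin (k * π * ξ) := by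
  funext ξ
  have h : HasDerivAt (fun ξ : ℝ => k * π * ξ) (k * π) ξ := hasDerivAt_const_mul _
  refine ((h.cos.const_mul √2).const_mul (k * π)).deriv.trans ?_
  ring

theorem deriv_deriv_fFun (k : ℕ) : deriv (deriv (fFun k)) = fun ξ => -(k * π) ^ 2 * fFun k ξ := by
  rw [deriv_fFun]
  funext ξ
  have h : HasDerivAt (fun ξ : ℝ => k * π * ξ) (k * π) ξ := hasDerivAt_const_mul _
  rw [(h.sin.const_mul _).deriv, fFun]
  ring

theorem integral_cos_int_mul_pi {n : ℤ} (hn : n ≠ 0) :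
    ∫ ξ, Real.cos (n * π * ξ) ∂vol01 = 0 := by
  have hne : (n : ℝ) * π ≠ 0 := mul_ne_zero (by exact_mod_cast hn) Real.pi_ne_zero
  rw [integral_vol01, intervalIntegral.integral_comp_mul_left (fun x => Real.cos x) hne]
  simp [integral_cos, Real.sin_int_mul_pi]

theorem integral_fFun {k : ℕ} (hk : 1 ≤ k) : ∫ ξ, fFun k ξ ∂vol01 = 0 := by
  have := integral_cos_int_mul_pi (n := k) (by omega)
  simp only [Int.cast_natCast] at this
  simp only [fFun, integral_const_mul, this, mul_zero]

theorem integral_fFun_mul_fFun {j k : ℕ} (hj : 1 ≤ j) :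
    ∫ ξ, fFun j ξ * fFun k ξ ∂vol01 = if j = k then (k * π) ^ 2 else 0 := by
  have product_to_sum (ξ : ℝ) : fFun j ξ * fFun k ξ = (j * π * (k * π)) *
      (Real.cos ((j - k : ℤ) * π * ξ) + Real.cos ((j + k : ℤ) * π * ξ)) := by
    have := Real.two_mul_cos_mul_cos (j * π * ξ) (k * π * ξ)
    have sq_sqrt_two : √2 * √2 = (2 : ℝ) := Real.mul_self_sqrt (by norm_num)
    push_cast
    rw [sub_mul, sub_mul, add_mul, add_mul, fFun, fFun]
    linear_combination (j * π * (k * π)) * this + (j * π * (k * π)) *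
      (Real.cos (j * π * ξ) * Real.cos (k * π * ξ)) * sq_sqrt_two
  simp_rw [product_to_sum]
  rw [integral_const_mul, integral_add (integrable_of_continuous (by fun_prop))
    (integrable_of_continuous (by fun_prop)), integral_cos_int_mul_pi (n := j + k) (by omega),
    add_zero]
  split_ifs with hjk
  · subst hjk
    simp [sq]
  · rw [integral_cos_int_mul_pi (by omega), mul_zero]

/-! ### Smooth elements of `V` and the operator `B` -/

theorem isWeakDeriv_of_contDiff {g : ℝ → ℝ} (hg : ContDiff ℝ 1 g) : IsWeakDeriv g (deriv g) := by
  have hc := hg.continuous_deriv le_rfl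
  have hi := integrable_of_continuous hc
  have hprim := (isWeakDeriv_primitive hi).add (isWeakDeriv_const (g 0))
    (integrable_primitive hi) (integrable_const _) hi (integrable_const _)
  refine hprim.congr (Eventually.of_forall fun x => ?_) (Eventually.of_forall fun x => ?_)
  · simp only [Pi.add_apply]
    rw [intervalIntegral.integral_deriv_eq_sub
      (fun x _ => (hg.differentiable one_ne_zero).differentiableAt) (hc.intervalIntegrable _ _),
      sub_add_cancel]
  · simp

/-- A `C¹` function with zero mean, as an element of `V`. -/
noncomputable def V.ofContDiff (g : ℝ → ℝ) (hg : ContDiff ℝ 1 g) (h0 : ∫ ξ, g ξ ∂vol01 = 0) : V :=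
  ⟨((memLp_of_continuous hg.continuous 2).toLp,
    (memLp_of_continuous (hg.continuous_deriv le_rfl) 2).toLp),
    (isWeakDeriv_of_contDiff hg).congr (memLp_of_continuous hg.continuous 2).coeFn_toLp.symm
      (memLp_of_continuous (hg.continuous_deriv le_rfl) 2).coeFn_toLp.symm, by
      rw [integral_congr_ae (memLp_of_continuous hg.continuous 2).coeFn_toLp, h0]⟩

theorem V.fn_ofContDiff {g : ℝ → ℝ} (hg : ContDiff ℝ 1 g) (h0 : ∫ ξ, g ξ ∂vol01 = 0) :
    V.fn (V.ofContDiff g hg h0) =ᵐ[vol01] g :=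
  (memLp_of_continuous hg.continuous 2).coeFn_toLp

theorem V.dn_ofContDiff {g : ℝ → ℝ} (hg : ContDiff ℝ 1 g) (h0 : ∫ ξ, g ξ ∂vol01 = 0) :
    V.dn (V.ofContDiff g hg h0) =ᵐ[vol01] deriv g :=
  (memLp_of_continuous (hg.continuous_deriv le_rfl) 2).coeFn_toLp

theorem V.eq_zero_of_fn_ae_eq_zero {y : V} (h : V.fn y =ᵐ[vol01] 0) : y = 0 := by
  have hd : V.dn y =ᵐ[vol01] 0 := by
    refine ae_eq_zero_of_integral_mul_test_eq_zero (integrable_L2 _) fun φ h1 h2 h3 => ?_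
    have := V.isWeakDeriv y φ h1 h2 h3
    rw [integral_eq_zero_of_ae (h.mono fun ξ hξ => by simp [hξ])] at this
    linarith
  exact V.ext (by rwa [map_zero, Lp.eq_zero_iff_ae_eq_zero])
    (by rwa [map_zero, Lp.eq_zero_iff_ae_eq_zero])

theorem V.integral_dn_mul (y : V) {g : ℝ → ℝ} (hg : ContDiff ℝ 1 g) (h0 : g 0 = 0)
    (h1 : g 1 = 0) : ∫ ξ, V.dn y ξ * g ξ ∂vol01 = - ∫ ξ, V.fn y ξ * deriv g ξ ∂vol01 := by
  obtain ⟨c, hc⟩ := (V.isWeakDeriv y).exists_eq_primitive (integrable_L2 _) (integrable_L2 _)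
  have hdn := intervalIntegrable_of_vol01 (integrable_L2 (V.dn y))
  have hprim := hdn.absolutelyContinuousOnInterval_intervalIntegral (c := 0) (by simp)
  have hga : AbsolutelyContinuousOnInterval g 0 1 := hg.contDiffOn.absolutelyContinuousOnInterval
  have hdc := hg.continuous_deriv le_rfl
  have integral_deriv : ∫ ξ, deriv g ξ ∂vol01 = 0 := by
    rw [integral_vol01, intervalIntegral.integral_deriv_eq_sub
      (fun x _ => (hg.differentiable one_ne_zero).differentiableAt) (hdc.intervalIntegrable _ _),
      h0, h1, sub_zero]
  have by_parts : ∫ ξ, (∫ t in (0 : ℝ)..ξ, V.dn y t) * deriv g ξ ∂vol01 =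
      -∫ ξ, V.dn y ξ * g ξ ∂vol01 := by
    rw [integral_vol01, integral_vol01, hprim.integral_mul_deriv_eq_deriv_mul hga, h0, h1,
      mul_zero, mul_zero, sub_zero, zero_sub, neg_inj]
    refine intervalIntegral.integral_congr_ae ?_
    filter_upwards [hdn.ae_hasDerivAt_integral] with x hx hx'
    rw [(hx (uIoc_subset_uIcc hx') 0 (by simp)).deriv]
  rw [integral_mul_congr_left hc]
  simp only [add_mul]
  rw [integral_add ((integrable_of_continuous hdc).const_mul c)
    (integrable_mul_continuous (integrable_primitive (integrable_L2 _)) hdc), integral_const_mul,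
    integral_deriv, by_parts, mul_zero, zero_add, neg_neg]

open Classical in
/-- The element `y ↦ ∫ g y` of `H` defined by a function `g ∈ L²(0, 1)`; zero if `g ∉ L²(0, 1)`. -/
noncomputable def ofFun (g : ℝ → ℝ) : H := if h : MemLp g 2 vol01 then ofL2 h.toLp else 0

theorem ofFun_eq_ofL2 {g : ℝ → ℝ} (hg : MemLp g 2 vol01) : ofFun g = ofL2 hg.toLp := dif_pos hg

theorem ofFun_of_not_memLp {g : ℝ → ℝ} (hg : ¬ MemLp g 2 vol01) : ofFun g = 0 := dif_neg hg

theorem ofFun_apply {g : ℝ → ℝ} (hg : MemLp g 2 vol01) (y : V) :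
    ofFun g y = ∫ ξ, g ξ * V.fn y ξ ∂vol01 := by
  rw [ofFun_eq_ofL2 hg, ofL2_apply]
  exact integral_mul_congr_left hg.coeFn_toLp _

theorem ofFun_add {g h : ℝ → ℝ} (hg : MemLp g 2 vol01) (hh : MemLp h 2 vol01) :
    ofFun (fun ξ => g ξ + h ξ) = ofFun g + ofFun h := by
  rw [ofFun_eq_ofL2 hg, ofFun_eq_ofL2 hh, ← map_add, ← hg.toLp_add hh, ← ofFun_eq_ofL2]
  rfl

theorem ofFun_sub {g h : ℝ → ℝ} (hg : MemLp g 2 vol01) (hh : MemLp h 2 vol01) :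
    ofFun (fun ξ => g ξ - h ξ) = ofFun g - ofFun h := by
  rw [ofFun_eq_ofL2 hg, ofFun_eq_ofL2 hh, ← map_sub, ← hg.toLp_sub hh, ← ofFun_eq_ofL2]
  rfl

theorem ofFun_const_mul {g : ℝ → ℝ} (hg : MemLp g 2 vol01) (c : ℝ) :
    ofFun (fun ξ => c * g ξ) = c • ofFun g := by
  rw [ofFun_eq_ofL2 hg, ← map_smul, ← hg.toLp_const_smul, ← ofFun_eq_ofL2]
  rfl

theorem ofFun_sum {ι : Type*} (s : Finset ι) {g : ι → ℝ → ℝ} (hg : ∀ i ∈ s, MemLp (g i) 2 vol01) :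
    ofFun (fun ξ => ∑ i ∈ s, g i ξ) = ∑ i ∈ s, ofFun (g i) := by
  classical
  induction s using Finset.induction_on with
  | empty => simp [ofFun_eq_ofL2 MemLp.zero']
  | insert a s ha ih =>
    have hs : ∀ i ∈ s, MemLp (g i) 2 vol01 := fun i hi => hg i (Finset.mem_insert_of_mem hi)
    simp only [Finset.sum_insert ha]
    rw [ofFun_add (hg a (Finset.mem_insert_self a s)) (memLp_finsetSum s hs), ih hs]

theorem B_ofContDiff {g : ℝ → ℝ} (hg : ContDiff ℝ 2 g) (h0 : ∫ ξ, g ξ ∂vol01 = 0)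
    (hg0 : deriv g 0 = 0) (hg1 : deriv g 1 = 0) :
    B (V.ofContDiff g (hg.of_le one_le_two) h0) = ofFun fun ξ => -deriv (deriv g) ξ := by
  have hdg : ContDiff ℝ 1 (deriv g) := (contDiff_succ_iff_deriv (n := 1).1 hg).2.2
  have hL2 : MemLp (fun ξ => -deriv (deriv g) ξ) 2 vol01 :=
    memLp_of_continuous (hdg.continuous_deriv le_rfl).neg 2
  refine ContinuousLinearMap.ext fun y => ?_
  change B _ y = ofFun _ y
  rw [B_apply, integral_mul_congr_left (V.dn_ofContDiff (hg.of_le one_le_two) h0)]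
  simp only [mul_comm (deriv g _)]
  rw [V.integral_dn_mul y hdg hg0 hg1, ofFun_apply hL2, ← integral_neg]
  simp only [neg_mul, mul_comm]

/-! ### The orthonormal basis of `H` -/

theorem ofFun_congr_ae {g h : ℝ → ℝ} (hg : MemLp g 2 vol01) (hgh : g =ᵐ[vol01] h) :
    ofFun g = ofFun h := by
  rw [ofFun_eq_ofL2 hg, ofFun_eq_ofL2 (hg.ae_eq hgh), (MemLp.toLp_eq_toLp_iff hg _).2 hgh]

theorem f_eq_ofFun (k : ℕ) : f k = ofFun (fFun k) := (ofFun_eq_ofL2 _).symm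

theorem Binv_eq_ofFun (x : H) : Binv x = ofFun (V.fn (B.symm x)) := by
  rw [ofFun_eq_ofL2 (Lp.memLp _), Lp.toLp_coeFn]
  rfl

theorem natCast_mul_pi_sq_pos {k : ℕ} (hk : 1 ≤ k) : 0 < ((k : ℝ) * π) ^ 2 := by positivity

theorem B_symm_f {k : ℕ} (hk : 1 ≤ k) : B.symm (f k) =
    (((k : ℝ) * π) ^ 2)⁻¹ • V.ofContDiff (fFun k) (contDiff_fFun k) (integral_fFun hk) := by
  have hB := B_ofContDiff (contDiff_fFun k) (integral_fFun hk) (by simp [deriv_fFun])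
    (by simp [deriv_fFun, Real.sin_nat_mul_pi])
  rw [deriv_deriv_fFun] at hB
  simp only [neg_mul, neg_neg] at hB
  rw [ofFun_const_mul (memLp_fFun k), ← f_eq_ofFun] at hB
  rw [B.symm_apply_eq, map_smul, hB, inv_smul_smul₀ (natCast_mul_pi_sq_pos hk).ne']

theorem fn_B_symm_f {k : ℕ} (hk : 1 ≤ k) :
    V.fn (B.symm (f k)) =ᵐ[vol01] fun ξ => ((k * π) ^ 2)⁻¹ * fFun k ξ := by
  rw [B_symm_f hk, map_smul]
  filter_upwards [Lp.coeFn_smul (((k : ℝ) * π) ^ 2)⁻¹ (V.fn (V.ofContDiff _ (contDiff_fFun k)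
    (integral_fFun hk))), V.fn_ofContDiff (contDiff_fFun k) (integral_fFun hk)] with ξ h1 h2
  rw [h1, Pi.smul_apply, h2, smul_eq_mul]

theorem inner_ofFun_f {g : ℝ → ℝ} (hg : MemLp g 2 vol01) {k : ℕ} (hk : 1 ≤ k) :
    inner ℝ (ofFun g) (f k) = ((k * π) ^ 2)⁻¹ * ∫ ξ, g ξ * fFun k ξ ∂vol01 := by
  rw [H.inner_def, ofFun_apply hg, ← integral_const_mul]
  refine integral_congr_ae ?_
  filter_upwards [fn_B_symm_f hk] with ξ h
  rw [h]; ring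

theorem inner_f_f {j k : ℕ} (hj : 1 ≤ j) (hk : 1 ≤ k) :
    inner ℝ (f j) (f k) = if j = k then (1 : ℝ) else 0 := by
  rw [f_eq_ofFun, inner_ofFun_f (memLp_fFun j) hk, integral_fFun_mul_fFun hj, mul_ite, mul_zero,
    inv_mul_cancel₀ (natCast_mul_pi_sq_pos hk).ne']

theorem norm_f {k : ℕ} (hk : 1 ≤ k) : ‖f k‖ = 1 := by
  rw [norm_eq_sqrt_real_inner, inner_f_f hk hk, if_pos rfl, Real.sqrt_one]

theorem eq_zero_of_inner_f_eq_zero {x : H} (h : ∀ k : ℕ, 1 ≤ k → inner ℝ x (f k) = 0) : x = 0 := by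
  suffices hz : B.symm x = 0 by rw [← B.apply_symm_apply x, hz, map_zero]
  refine V.eq_zero_of_fn_ae_eq_zero
    (ae_eq_zero_of_integral_mul_cos_eq_zero (integrable_L2 _) fun k => ?_)
  rcases Nat.eq_zero_or_pos k with rfl | hk
  · simpa using V.integral_eq_zero (B.symm x)
  · have hxk := h k hk
    rw [real_inner_comm, H.inner_def, f_eq_ofFun, ofFun_apply (memLp_fFun k)] at hxk
    simp only [fFun, mul_assoc, integral_const_mul] at hxk
    simpa [mul_assoc, mul_comm, mul_left_comm, Nat.ne_of_gt hk] using hxk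

theorem eq_of_inner_f_eq {x y : H} (h : ∀ k : ℕ, 1 ≤ k → inner ℝ x (f k) = inner ℝ y (f k)) :
    x = y := by
  refine sub_eq_zero.1 (eq_zero_of_inner_f_eq_zero fun k hk => ?_)
  rw [inner_sub_left, h k hk, sub_self]

theorem orthonormal_f : Orthonormal ℝ (fun i : ℕ => f (i + 1)) := by
  rw [orthonormal_iff_ite]
  intro i j
  rw [inner_f_f (by omega) (by omega)]
  simp

/-- The Hilbert basis `f_1, f_2, …` of `H`, indexed from zero: `basisH i = f_{i+1}`. -/
noncomputable def basisH : HilbertBasis ℕ ℝ H :=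
  HilbertBasis.mkOfOrthogonalEqBot orthonormal_f (by
    refine (Submodule.eq_bot_iff _).2 fun x hx => eq_zero_of_inner_f_eq_zero fun k hk => ?_
    obtain ⟨i, rfl⟩ := Nat.exists_eq_add_of_le' hk
    rw [real_inner_comm]
    exact (Submodule.mem_orthogonal _ _).1 hx _ (Submodule.subset_span ⟨i, rfl⟩))

theorem basisH_apply (i : ℕ) : basisH i = f (i + 1) := by simp [basisH]

theorem P_eq_sum_range (n : ℕ) (x : H) :
    P n x = ∑ i ∈ Finset.range n, inner ℝ x (f (i + 1)) • f (i + 1) := by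
  rw [Finset.range_eq_Ico, Finset.sum_Ico_add' (fun k => inner ℝ x (f k) • f k) 0 n 1]
  rfl

theorem continuous_P (n : ℕ) : Continuous (P n) := by
  unfold P; fun_prop

theorem tendsto_P (x : H) : Tendsto (fun n => P n x) atTop (𝓝 x) := by
  have := (basisH.hasSum_repr x).tendsto_sum_nat
  simp only [HilbertBasis.repr_apply_apply, basisH_apply] at this
  simpa only [P_eq_sum_range, real_inner_comm] using this

theorem inner_P_f {n k : ℕ} (hk : 1 ≤ k) (x : H) :
    inner ℝ (P n x) (f k) = if k ≤ n then inner ℝ x (f k) else 0 := by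
  have coord (j : ℕ) (hj : j ∈ Finset.Icc 1 n) : inner ℝ (inner ℝ x (f j) • f j) (f k) =
      if j = k then inner ℝ x (f j) else 0 := by
    rw [real_inner_smul_left, inner_f_f (Finset.mem_Icc.1 hj).1 hk, mul_ite, mul_one, mul_zero]
  rw [P, sum_inner, Finset.sum_congr rfl coord, Finset.sum_ite_eq']
  simp [hk]

theorem norm_P_le (n : ℕ) (x : H) : ‖P n x‖ ≤ ‖x‖ := by
  have orthogonal : inner ℝ (P n x) (x - P n x) = 0 := by
    conv_lhs => arg 2; rw [P]
    rw [sum_inner]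
    refine Finset.sum_eq_zero fun k hk => ?_
    obtain ⟨hk1, hkn⟩ := Finset.mem_Icc.1 hk
    rw [real_inner_smul_left, real_inner_comm (x - P n x), inner_sub_left, inner_P_f hk1,
      if_pos hkn, sub_self, mul_zero]
  have pythagoras := norm_add_sq_eq_norm_sq_add_norm_sq_real orthogonal
  rw [add_sub_cancel] at pythagoras
  nlinarith [norm_nonneg x, norm_nonneg (P n x), mul_self_nonneg ‖x - P n x‖]

theorem Binv_f {k : ℕ} (hk : 1 ≤ k) : Binv (f k) = ((k * π) ^ 2)⁻¹ • f k := by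
  rw [Binv_eq_ofFun, ofFun_congr_ae (Lp.memLp _) (fn_B_symm_f hk), ofFun_const_mul (memLp_fFun k),
    f_eq_ofFun]

theorem sqrt_eig (k : ℕ) : √(eig k) = (√2)⁻¹ * ((k * π) ^ 2)⁻¹ := by
  have : eig k = ((√2)⁻¹ * ((k * π) ^ 2)⁻¹) ^ 2 := by
    rw [mul_pow, inv_pow, Real.sq_sqrt (by norm_num), eig]
    field_simp
  rw [this, Real.sqrt_sq (by positivity)]

theorem eig_pos {k : ℕ} (hk : 1 ≤ k) : 0 < eig k := by unfold eig; positivity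

theorem Qhalf_f {k : ℕ} (hk : 1 ≤ k) : Qhalf (f k) = √(eig k) • f k := by
  rw [Qhalf, _root_.smul_apply, Binv_f hk, smul_smul, sqrt_eig]

theorem Q_f {k : ℕ} (hk : 1 ≤ k) : Q (f k) = eig k • f k := by
  rw [← Qhalf_comp_Qhalf, ContinuousLinearMap.comp_apply, Qhalf_f hk, map_smul, Qhalf_f hk,
    smul_smul, Real.mul_self_sqrt (eig_pos hk).le]

instance : SecondCountableTopology H := by
  have : Fact ((2 : ℝ≥0∞) ≠ ⊤) := ⟨by norm_num⟩
  let e : V ≃ₗᵢ[ℝ] L2 := LinearIsometryEquiv.ofSurjective ⟨V.dn, V.norm_dn⟩ V.dn_surjective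
  exact (B.symm.trans e).toHomeomorph.secondCountableTopology

/-! ### Functions representing elements of `H` -/

theorem Represents.mono {p q : ℝ≥0∞} {g : ℝ → ℝ} {x : H} (h : Represents p g x) (hqp : q ≤ p) :
    Represents q g x := ⟨h.1.mono_exponent hqp, h.2⟩

theorem represents_ofFun {p : ℝ≥0∞} {g : ℝ → ℝ} (hp : MemLp g p vol01) (h2 : MemLp g 2 vol01)
    (h0 : ∫ ξ, g ξ ∂vol01 = 0) : Represents p g (ofFun g) :=
  ⟨hp, h0, ofFun_apply h2⟩

theorem Represents.exists_apply_eq_integral {φ : ℝ → ℝ} (hφ : ContDiff ℝ 1 φ) :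
    ∃ y : V, ∀ {g : ℝ → ℝ} {x : H}, Represents 1 g x → x y = ∫ ξ, g ξ * φ ξ ∂vol01 := by
  -- Elements of `V` have zero mean; as `g` does too, `φ` may be replaced by `φ - ∫ φ`.
  set m := ∫ ξ, φ ξ ∂vol01 with hm
  have mean_zero : ∫ ξ, φ ξ - m ∂vol01 = 0 := by
    rw [integral_sub (integrable_of_continuous hφ.continuous) (integrable_const _)]
    simp [hm]
  refine ⟨V.ofContDiff (fun ξ => φ ξ - m) (hφ.sub contDiff_const) mean_zero, fun {g x} hg => ?_⟩
  have hgi := memLp_one_iff_integrable.1 hg.1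
  have hfn := V.fn_ofContDiff (hφ.sub contDiff_const) mean_zero
  simp_rw [hg.2.2, mul_comm (g _)]
  rw [integral_mul_congr_left hfn]
  simp_rw [sub_mul, mul_comm _ (g _)]
  rw [integral_sub (integrable_mul_continuous hgi hφ.continuous) (hgi.mul_const m),
    integral_mul_const, hg.2.1, zero_mul, sub_zero]

theorem Represents.ae_eq {g h : ℝ → ℝ} {x : H} (hg : Represents 1 g x) (hh : Represents 1 h x) :
    g =ᵐ[vol01] h := by
  have hgi := memLp_one_iff_integrable.1 hg.1
  have hhi := memLp_one_iff_integrable.1 hh.1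
  refine (ae_eq_zero_of_integral_mul_test_eq_zero (hgi.sub hhi) fun φ hφ _ _ => ?_).mono
    fun ξ hξ => sub_eq_zero.1 hξ
  obtain ⟨y, hy⟩ := Represents.exists_apply_eq_integral (hφ.of_le (by simp))
  simp only [Pi.sub_apply, sub_mul]
  rw [integral_sub (integrable_mul_continuous hgi hφ.continuous)
    (integrable_mul_continuous hhi hφ.continuous), ← hy hg, ← hy hh, sub_self]

theorem toFun_ae_eq {g : ℝ → ℝ} {x : H} (h : Represents 1 g x) : toFun x =ᵐ[vol01] g := by
  have hex : ∃ g, Represents 1 g x := ⟨g, h⟩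
  rw [toFun, dif_pos hex]
  exact hex.choose_spec.ae_eq h

theorem U_eq_of_represents {Φ : ℝ → ℝ} {p₂ : ℝ} (hp : 0 ≤ p₂) {g : ℝ → ℝ} {x : H}
    (h : Represents (ENNReal.ofReal (p₂ + 1)) g x) :
    U Φ p₂ x = ((∫ ξ, Φ (g ξ) ∂vol01 : ℝ) : EReal) := by
  have one_le : (1 : ℝ≥0∞) ≤ ENNReal.ofReal (p₂ + 1) := by
    rw [ENNReal.one_le_ofReal]; linarith
  have hΦ : Φ ∘ toFun x =ᵐ[vol01] Φ ∘ g := (toFun_ae_eq (h.mono one_le)).fun_comp Φ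
  rw [U, if_pos ⟨g, h⟩]
  exact congrArg Real.toEReal (integral_congr_ae hΦ)

theorem P_eq_ofFun (n : ℕ) (x : H) :
    P n x = ofFun fun ξ => ∑ k ∈ Finset.Icc 1 n, inner ℝ x (f k) * fFun k ξ := by
  rw [ofFun_sum _ fun k _ => (memLp_fFun k).const_mul _, P]
  exact Finset.sum_congr rfl fun k _ => by rw [ofFun_const_mul (memLp_fFun k), f_eq_ofFun]

theorem represents_P (n : ℕ) (x : H) (p : ℝ≥0∞) :
    Represents p (fun ξ => ∑ k ∈ Finset.Icc 1 n, inner ℝ x (f k) * fFun k ξ) (P n x) := by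
  have hc : Continuous fun ξ => ∑ k ∈ Finset.Icc 1 n, inner ℝ x (f k) * fFun k ξ :=
    continuous_finsetSum _ fun k _ => continuous_const.mul (continuous_fFun k)
  rw [P_eq_ofFun]
  refine represents_ofFun (memLp_of_continuous hc p) (memLp_of_continuous hc 2) ?_
  rw [integral_finsetSum _ fun k _ => (integrable_of_continuous (continuous_fFun k)).const_mul _]
  refine Finset.sum_eq_zero fun k hk => ?_
  rw [integral_const_mul, integral_fFun (Finset.mem_Icc.1 hk).1, mul_zero]

theorem U_P (Φ : ℝ → ℝ) {p₂ : ℝ} (hp : 0 ≤ p₂) (n : ℕ) (x : H) :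
    U Φ p₂ (P n x) = (Un Φ n x : EReal) :=
  U_eq_of_represents hp (represents_P n x _)

/-! ### Mixed norms and limits in `L^q` -/

section MixedNorms

variable {X Y E F : Type*} {mX : MeasurableSpace X} {mY : MeasurableSpace Y}
  [NormedAddCommGroup E] [NormedAddCommGroup F] {μ : Measure X} {ρ : Measure Y} {q : ℝ≥0∞}

theorem eLpNorm_le_mul_eLpNorm_prod [SFinite ρ] {h : X × Y → F}
    (hh : AEStronglyMeasurable h (μ.prod ρ)) (hq : q ≠ ⊤) {c : ℝ≥0∞} (hc : c ≠ ⊤) {G : X → E}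
    (hG : ∀ᵐ x ∂μ, ‖G x‖ₑ ≤ c * eLpNorm (fun y => h (x, y)) q ρ) :
    eLpNorm G q μ ≤ c * eLpNorm h q (μ.prod ρ) := by
  rcases eq_or_ne q 0 with rfl | hq0
  · simp
  have hq' : 0 < q.toReal := ENNReal.toReal_pos hq0 hq
  have lintegral_le : ∫⁻ x, ‖G x‖ₑ ^ q.toReal ∂μ ≤
      c ^ q.toReal * ∫⁻ z, ‖h z‖ₑ ^ q.toReal ∂μ.prod ρ := by
    rw [lintegral_prod _ (hh.enorm.pow_const _),
      ← lintegral_const_mul' _ _ (ENNReal.rpow_ne_top_of_nonneg hq'.le hc)]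
    refine lintegral_mono_ae (hG.mono fun x hx => ?_)
    rw [eLpNorm_eq_lintegral_rpow_enorm_toReal hq0 hq] at hx
    refine (ENNReal.rpow_le_rpow hx hq'.le).trans_eq ?_
    rw [ENNReal.mul_rpow_of_nonneg _ _ hq'.le, one_div, ENNReal.rpow_inv_rpow hq'.ne']
  rw [eLpNorm_eq_lintegral_rpow_enorm_toReal hq0 hq, eLpNorm_eq_lintegral_rpow_enorm_toReal hq0 hq]
  refine (ENNReal.rpow_le_rpow lintegral_le (by positivity)).trans_eq ?_
  rw [ENNReal.mul_rpow_of_nonneg _ _ (by positivity), one_div, ENNReal.rpow_rpow_inv hq'.ne']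

theorem eLpNorm_prod_le_of_forall [SFinite μ] [IsProbabilityMeasure ρ] {h : X × Y → F}
    (hh : AEStronglyMeasurable h (μ.prod ρ)) (hq : q ≠ ⊤) {K : ℝ≥0∞}
    (hK : ∀ y, eLpNorm (fun x => h (x, y)) q μ ≤ K) : eLpNorm h q (μ.prod ρ) ≤ K := by
  rcases eq_or_ne q 0 with rfl | hq0
  · simp
  have hq' : 0 < q.toReal := ENNReal.toReal_pos hq0 hq
  simp_rw [eLpNorm_eq_lintegral_rpow_enorm_toReal hq0 hq, one_div,
    ENNReal.rpow_inv_le_iff hq'] at hK ⊢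
  rw [lintegral_prod_symm _ (hh.enorm.pow_const _)]
  simpa using lintegral_mono (μ := ρ) hK

theorem ae_memLp_prodMk [SFinite ρ] {h : X × Y → F} (hh : MemLp h q (μ.prod ρ)) (hq : q ≠ ⊤) :
    ∀ᵐ x ∂μ, MemLp (fun y => h (x, y)) q ρ := by
  rcases eq_or_ne q 0 with rfl | hq0
  · simpa using hh.1.prodMk_left
  have hm : AEMeasurable (fun z => ‖h z‖ₑ ^ q.toReal) (μ.prod ρ) := hh.1.enorm.pow_const _
  have finite := hh.2
  rw [eLpNorm_lt_top_iff_lintegral_rpow_enorm_lt_top hq0 hq, lintegral_prod _ hm] at finite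
  filter_upwards [hh.1.prodMk_left, ae_lt_top' hm.lintegral_prod_right' finite.ne] with x hx hx'
  exact ⟨hx, (eLpNorm_lt_top_iff_lintegral_rpow_enorm_lt_top hq0 hq).2 hx'⟩

theorem eLpNorm_integral_le [NormedSpace ℝ F] [IsProbabilityMeasure ρ] {h : X × Y → F}
    (hh : AEStronglyMeasurable h (μ.prod ρ)) (hq1 : 1 ≤ q) (hq : q ≠ ⊤) :
    eLpNorm (fun x => ∫ y, h (x, y) ∂ρ) q μ ≤ eLpNorm h q (μ.prod ρ) := by
  rw [← one_mul (eLpNorm h q _)]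
  refine eLpNorm_le_mul_eLpNorm_prod hh hq ENNReal.one_ne_top ?_
  filter_upwards [hh.prodMk_left] with x hx
  rw [one_mul]
  refine (enorm_integral_le_lintegral_enorm _).trans ?_
  rw [← eLpNorm_one_eq_lintegral_enorm]
  exact eLpNorm_le_eLpNorm_of_exponent_le hq1 hx

theorem memLp_integral [NormedSpace ℝ F] [IsProbabilityMeasure ρ] [SFinite μ] {h : X × Y → F}
    (hh : MemLp h q (μ.prod ρ)) (hq1 : 1 ≤ q) (hq : q ≠ ⊤) :
    MemLp (fun x => ∫ y, h (x, y) ∂ρ) q μ :=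
  ⟨hh.1.integral_prod_right', (eLpNorm_integral_le hh.1 hq1 hq).trans_lt hh.2⟩

end MixedNorms

section LqLimits

variable {Ω E : Type*} {mΩ : MeasurableSpace Ω} {ν : Measure Ω} [NormedAddCommGroup E] {q : ℝ≥0∞}

theorem eLpNorm_indicator_le_norm_le (g : Ω → E) (q : ℝ≥0∞) {C : NNReal} (hC : C ≠ 0) :
    eLpNorm ({x | C ≤ ‖g x‖₊}.indicator g) q ν ≤ (C : ℝ≥0∞)⁻¹ * eLpNorm g (q * 2) ν ^ 2 := by
  have pointwise (x : Ω) :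
      ‖{x | C ≤ ‖g x‖₊}.indicator g x‖ ≤ ‖((C : ℝ)⁻¹ • fun x => ‖g x‖ ^ (2 : ℝ)) x‖ := by
    by_cases hx : C ≤ ‖g x‖₊
    · have hCx : (C : ℝ) ≤ ‖g x‖ := hx
      have hC0 : (0 : ℝ) < C := NNReal.coe_pos.2 (pos_iff_ne_zero.2 hC)
      rw [indicator_of_mem (by exact hx), Pi.smul_apply, smul_eq_mul, Real.rpow_two,
        Real.norm_of_nonneg (by positivity), inv_mul_eq_div, le_div_iff₀ hC0, sq]
      gcongr
    · rw [indicator_of_notMem (by exact hx), norm_zero]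
      exact norm_nonneg _
  refine (eLpNorm_mono pointwise).trans_eq ?_
  rw [eLpNorm_const_smul, eLpNorm_norm_rpow _ two_pos, ENNReal.ofReal_ofNat, ENNReal.rpow_two,
    enorm_inv (by exact_mod_cast hC)]
  simp

theorem unifIntegrable_of_eLpNorm_two_mul_le {g : ℕ → Ω → E} (hq1 : 1 ≤ q) (hq : q ≠ ⊤)
    (hg : ∀ n, AEStronglyMeasurable (g n) ν) {K : ℝ≥0∞} (hK : K ≠ ⊤)
    (hgK : ∀ n, eLpNorm (g n) (q * 2) ν ≤ K) : UnifIntegrable g q ν := by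
  refine unifIntegrable_of hq1 hq hg fun ε hε => ?_
  have small : Tendsto (fun C : NNReal => (C : ℝ≥0∞)⁻¹ * K ^ 2) atTop (𝓝 0) := by
    have inv_tendsto : Tendsto (fun C : NNReal => (C : ℝ≥0∞)⁻¹) atTop (𝓝 0) :=
      tendsto_inv_iff.1 (by simpa using ENNReal.tendsto_coe_nhds_top.2 tendsto_id)
    simpa using ENNReal.Tendsto.mul_const inv_tendsto (Or.inr (ENNReal.pow_ne_top hK))
  obtain ⟨C, hC, hC0⟩ := ((small.eventually_le_const (ENNReal.ofReal_pos.2 hε)).and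
    (eventually_ne_atTop 0)).exists
  refine ⟨C, fun n => (eLpNorm_indicator_le_norm_le (g n) q hC0).trans (le_trans ?_ hC)⟩
  gcongr
  exact hgK n

theorem eLpNorm_comp_le [IsProbabilityMeasure ν] {T : Ω → ℝ} (hT : AEStronglyMeasurable T ν)
    {F : ℝ → ℝ} {A r : ℝ} (hr : 0 < r) (hF : ∀ t, |F t| ≤ A * (1 + |t| ^ r)) (hq : 1 ≤ q) :
    eLpNorm (fun z => F (T z)) q ν ≤
      ENNReal.ofReal A * (1 + eLpNorm T (q * ENNReal.ofReal r) ν ^ r) := by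
  have hA : 0 ≤ A := by
    simpa [Real.zero_rpow hr.ne'] using (abs_nonneg _).trans (hF 0)
  have growth : eLpNorm (fun z => F (T z)) q ν ≤
      eLpNorm (A • ((fun _ => (1 : ℝ)) + fun z => ‖T z‖ ^ r)) q ν := by
    refine eLpNorm_mono fun z => (hF (T z)).trans_eq ?_
    simp only [Pi.smul_apply, Pi.add_apply, smul_eq_mul, Real.norm_eq_abs]
    rw [abs_of_nonneg (by positivity : 0 ≤ A * (1 + |T z| ^ r))]
  refine growth.trans ?_
  rw [eLpNorm_const_smul, Real.enorm_of_nonneg hA]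
  gcongr
  refine (eLpNorm_add_le aestronglyMeasurable_const
    (hT.norm.aemeasurable.pow_const r).aestronglyMeasurable hq).trans_eq ?_
  rw [eLpNorm_norm_rpow _ hr, eLpNorm_const _ (by positivity) (NeZero.ne ν)]
  simp

theorem memLp_comp [IsProbabilityMeasure ν] {T : Ω → ℝ} (hT : ∀ q : ℝ≥0∞, q ≠ ⊤ → MemLp T q ν)
    {F : ℝ → ℝ} (hFc : Continuous F) {A r : ℝ} (hr : 0 < r)
    (hF : ∀ t, |F t| ≤ A * (1 + |t| ^ r)) (hq1 : 1 ≤ q) (hq : q ≠ ⊤) :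
    MemLp (fun z => F (T z)) q ν := by
  have hTr := hT (q * ENNReal.ofReal r) (ENNReal.mul_ne_top hq ENNReal.ofReal_ne_top)
  refine ⟨hFc.comp_aestronglyMeasurable hTr.1, (eLpNorm_comp_le hTr.1 hr hF hq1).trans_lt ?_⟩
  exact ENNReal.mul_lt_top ENNReal.ofReal_lt_top
    (ENNReal.add_lt_top.2 ⟨ENNReal.one_lt_top, ENNReal.rpow_lt_top_of_nonneg hr.le hTr.2.ne⟩)

theorem tendsto_eLpNorm_comp_sub [IsProbabilityMeasure ν] {T : ℕ → Ω → ℝ} {T' : Ω → ℝ}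
    (hT : ∀ n, AEStronglyMeasurable (T n) ν)
    (hTb : ∀ q : ℝ≥0∞, q ≠ ⊤ → ∃ K : ℝ≥0∞, K ≠ ⊤ ∧ ∀ n, eLpNorm (T n) q ν ≤ K)
    (hT' : ∀ q : ℝ≥0∞, q ≠ ⊤ → MemLp T' q ν) (hlim : TendstoInMeasure ν T atTop T')
    {Λ : Type*} [TopologicalSpace Λ] {F : Λ → ℝ → ℝ} (hFc : Continuous fun p : Λ × ℝ => F p.1 p.2)
    {A r : ℝ} (hr : 0 < r) (hF : ∀ a t, |F a t| ≤ A * (1 + |t| ^ r)) {a : ℕ → Λ} {a' : Λ}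
    (ha : Tendsto a atTop (𝓝 a')) (hq1 : 1 ≤ q) (hq : q ≠ ⊤) :
    Tendsto (fun n => eLpNorm (fun z => F (a n) (T n z) - F a' (T' z)) q ν) atTop (𝓝 0) := by
  have hFc' (a : Λ) : Continuous (F a) := hFc.comp (Continuous.prodMk_right a)
  obtain ⟨K, hK, hTK⟩ := hTb (q * 2 * ENNReal.ofReal r)
    (ENNReal.mul_ne_top (ENNReal.mul_ne_top hq (by simp)) ENNReal.ofReal_ne_top)
  refine tendsto_of_subseq_tendsto fun ns hns => ?_
  obtain ⟨ms, hms, hae⟩ :=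
    TendstoInMeasure.exists_seq_tendsto_ae fun ε hε => (hlim ε hε).comp hns
  have hidx : Tendsto (fun i => ns (ms i)) atTop atTop := hns.comp hms.tendsto_atTop
  have hmeas (i : ℕ) : AEStronglyMeasurable (fun z => F (a (ns (ms i))) (T (ns (ms i)) z)) ν :=
    (hFc' _).comp_aestronglyMeasurable (hT _)
  have unifIntegrable : UnifIntegrable (fun i z => F (a (ns (ms i))) (T (ns (ms i)) z)) q ν := by
    refine unifIntegrable_of_eLpNorm_two_mul_le (K := ENNReal.ofReal A * (1 + K ^ r)) hq1 hq hmeas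
      (by finiteness) fun i => ?_
    refine (eLpNorm_comp_le (hT _) hr (hF _) (hq1.trans ?_)).trans ?_
    · exact le_mul_of_one_le_right zero_le one_le_two
    · gcongr
      exact hTK _
  refine ⟨ms, tendsto_Lp_finite_of_tendsto_ae hq1 hq hmeas
    (memLp_comp hT' (hFc' a') hr (hF a') hq1 hq) unifIntegrable ?_⟩
  filter_upwards [hae] with z hz
  exact (hFc.tendsto (a', T' z)).comp ((ha.comp hidx).prodMk_nhds hz)

theorem exists_tendsto_eLpNorm_of_cauchy [CompleteSpace E] {g : ℕ → Ω → E} (hq : 1 ≤ q)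
    (hg : ∀ n, MemLp (g n) q ν) {b : ℕ → ℝ≥0∞} (hb : Tendsto b atTop (𝓝 0))
    (hgb : ∀ N m n, N ≤ m → N ≤ n → eLpNorm (g m - g n) q ν ≤ b N) :
    ∃ S : Ω → E, StronglyMeasurable S ∧ Tendsto (fun n => eLpNorm (g n - S) q ν) atTop (𝓝 0) := by
  have : Fact (1 ≤ q) := ⟨hq⟩
  have cauchy : CauchySeq fun n => (hg n).toLp := by
    refine (EMetric.cauchySeq_iff_le_tendsto_0 (α := Lp E q ν)).2 ⟨b, fun m n N hm hn => ?_, hb⟩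
    rw [Lp.edist_toLp_toLp]
    exact hgb N m n hm hn
  obtain ⟨S, hS⟩ := cauchySeq_tendsto_of_complete cauchy
  refine ⟨S, Lp.stronglyMeasurable S, ((Lp.tendsto_Lp_iff_tendsto_eLpNorm' _ _).1 hS).congr
    fun n => eLpNorm_congr_ae ((hg n).coeFn_toLp.sub EventuallyEq.rfl)⟩

theorem exists_eLpNorm_sub_le_of_cauchy [CompleteSpace E] {g : ℕ → Ω → E}
    {b : ℝ≥0∞ → ℕ → ℝ≥0∞} (hg : ∀ n, MemLp (g n) 1 ν) (hb : Tendsto (b 1) atTop (𝓝 0))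
    (hgb : ∀ q ≠ ⊤, ∀ N m n, N ≤ m → N ≤ n → eLpNorm (g m - g n) q ν ≤ b q N) :
    ∃ S : Ω → E, StronglyMeasurable S ∧ ∀ q ≠ ⊤, ∀ n, eLpNorm (g n - S) q ν ≤ b q n := by
  obtain ⟨S, hS, hlim⟩ :=
    exists_tendsto_eLpNorm_of_cauchy le_rfl hg hb (hgb 1 ENNReal.one_ne_top)
  have hmeas : TendstoInMeasure ν g atTop S :=
    tendstoInMeasure_of_tendsto_eLpNorm one_ne_zero (fun n => (hg n).1) hS.aestronglyMeasurable hlim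
  refine ⟨S, hS, fun q hq n => ?_⟩
  have hsub : TendstoInMeasure ν (fun m => g n - g m) atTop (g n - S) := fun ε hε =>
    (hmeas ε hε).congr fun m => by simp only [Pi.sub_apply, edist_sub_left]
  refine eLpNorm_le_of_tendstoInMeasure ?_ hsub fun m => (hg n).1.sub (hg m).1
  filter_upwards [eventually_ge_atTop n] with m hm using hgb q hq n n m le_rfl hm

end LqLimits

/-! ### Bounded `C¹` functions -/

/-- The class `C¹_b(E)` of `C¹` functions that are bounded with bounded derivative. -/
structure IsC1b {E : Type*} [NormedAddCommGroup E] [NormedSpace ℝ E] (F : E → ℝ) : Prop where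
  contDiff : ContDiff ℝ 1 F
  bdd : ∃ C : ℝ, ∀ x, |F x| ≤ C
  bdd_fderiv : ∃ C : ℝ, ∀ x, ‖fderiv ℝ F x‖ ≤ C

namespace IsC1b

variable {E E' : Type*} [NormedAddCommGroup E] [NormedSpace ℝ E] [NormedAddCommGroup E']
  [NormedSpace ℝ E'] {F G : E → ℝ}

theorem differentiable (hF : IsC1b F) : Differentiable ℝ F :=
  hF.contDiff.differentiable one_ne_zero

theorem continuous (hF : IsC1b F) : Continuous F := hF.contDiff.continuous

theorem continuous_fderiv_apply (hF : IsC1b F) (v : E) : Continuous fun x => fderiv ℝ F x v :=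
  (hF.contDiff.continuous_fderiv one_ne_zero).clm_apply continuous_const

theorem bdd_fderiv_apply (hF : IsC1b F) (v : E) : ∃ C : ℝ, ∀ x, |fderiv ℝ F x v| ≤ C := by
  obtain ⟨C, hC⟩ := hF.bdd_fderiv
  exact ⟨C * ‖v‖, fun x => (ContinuousLinearMap.le_opNorm _ _).trans
    (mul_le_mul_of_nonneg_right (hC x) (norm_nonneg _))⟩

theorem mul (hF : IsC1b F) (hG : IsC1b G) : IsC1b fun x => F x * G x := by
  obtain ⟨A, hA⟩ := hF.bdd
  obtain ⟨B, hB⟩ := hG.bdd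
  obtain ⟨A', hA'⟩ := hF.bdd_fderiv
  obtain ⟨B', hB'⟩ := hG.bdd_fderiv
  refine ⟨hF.contDiff.mul hG.contDiff, ⟨A * B, fun x => ?_⟩, ⟨A * B' + B * A', fun x => ?_⟩⟩
  · rw [abs_mul]
    exact mul_le_mul (hA x) (hB x) (abs_nonneg _) ((abs_nonneg _).trans (hA x))
  · rw [fderiv_fun_mul hF.differentiable.differentiableAt hG.differentiable.differentiableAt]
    refine (norm_add_le _ _).trans ?_
    rw [norm_smul, norm_smul]
    exact add_le_add
      (mul_le_mul (hA x) (hB' x) (norm_nonneg _) ((abs_nonneg _).trans (hA x)))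
      (mul_le_mul (hB x) (hA' x) (norm_nonneg _) ((abs_nonneg _).trans (hB x)))

theorem comp_clm {F : E' → ℝ} (hF : IsC1b F) (L : E →L[ℝ] E') : IsC1b fun x => F (L x) := by
  obtain ⟨A, hA⟩ := hF.bdd
  obtain ⟨A', hA'⟩ := hF.bdd_fderiv
  refine ⟨hF.contDiff.comp L.contDiff, ⟨A, fun x => hA _⟩, ⟨A' * ‖L‖, fun x => ?_⟩⟩
  rw [fderiv_fun_comp x hF.differentiable.differentiableAt L.differentiableAt, L.fderiv]
  exact (ContinuousLinearMap.opNorm_comp_le _ _).trans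
    (mul_le_mul_of_nonneg_right (hA' _) (norm_nonneg _))

theorem comp_inner {E : Type*} [NormedAddCommGroup E] [InnerProductSpace ℝ E] {F : ℝ → ℝ}
    (hF : IsC1b F) (y : E) : IsC1b fun x : E => F (inner ℝ x y) := by
  simpa only [innerSL_apply_apply, real_inner_comm y] using hF.comp_clm (innerSL ℝ y)

theorem of_deriv {g : ℝ → ℝ} (hg : ContDiff ℝ 1 g) {C C' : ℝ} (hb : ∀ t, |g t| ≤ C)
    (hd : ∀ t, |deriv g t| ≤ C') : IsC1b g :=
  ⟨hg, ⟨C, hb⟩, C', fun x => by rw [← norm_deriv_eq_norm_fderiv]; exact hd x⟩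

variable [MeasurableSpace E] [OpensMeasurableSpace E] {μ : Measure E} [IsFiniteMeasure μ]

theorem memLp (hF : IsC1b F) (p : ℝ≥0∞) : MemLp F p μ := by
  obtain ⟨C, hC⟩ := hF.bdd
  exact MemLp.of_bound hF.continuous.aestronglyMeasurable C (Eventually.of_forall hC)

theorem memLp_fderiv_apply (hF : IsC1b F) (v : E) (p : ℝ≥0∞) :
    MemLp (fun x => fderiv ℝ F x v) p μ := by
  obtain ⟨C, hC⟩ := hF.bdd_fderiv_apply v
  exact MemLp.of_bound (hF.continuous_fderiv_apply v).aestronglyMeasurable C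
    (Eventually.of_forall hC)

end IsC1b

theorem isC1b_cos : IsC1b Real.cos :=
  .of_deriv Real.contDiff_cos Real.abs_cos_le_one fun t => by
    rw [Real.deriv_cos, abs_neg]; exact Real.abs_sin_le_one t

theorem isC1b_sin : IsC1b Real.sin :=
  .of_deriv Real.contDiff_sin Real.abs_sin_le_one fun t => by
    rw [Real.deriv_sin]; exact Real.abs_cos_le_one t

theorem isC1b_inv_one_add_sq : IsC1b fun t : ℝ => (1 + t ^ 2)⁻¹ := by
  have hpos (t : ℝ) : 0 < 1 + t ^ 2 := by positivity
  refine .of_deriv (C := 1) (C' := 1) (ContDiff.inv (by fun_prop) fun t => (hpos t).ne')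
    (fun t => ?_) fun t => ?_
  · rw [abs_of_nonneg (by positivity)]
    exact inv_le_one_of_one_le₀ (by nlinarith [sq_nonneg t])
  · have h : HasDerivAt (fun t : ℝ => 1 + t ^ 2) (2 * t) t := by
      simpa using (hasDerivAt_pow 2 t).const_add 1
    rw [(h.fun_inv (hpos t).ne').deriv, abs_div, abs_neg,
      abs_of_nonneg (by positivity : (0 : ℝ) ≤ (1 + t ^ 2) ^ 2), div_le_one (by positivity), abs_le]
    constructor <;> nlinarith [sq_nonneg (t - 1), sq_nonneg (t + 1), sq_nonneg t, sq_nonneg (t ^ 2)]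

theorem abs_mul_inv_one_add_sq_le (s : ℝ) : |s * (1 + s ^ 2)⁻¹| ≤ 1 := by
  rw [abs_mul, abs_inv, abs_of_pos (by positivity : 0 < 1 + s ^ 2), ← div_eq_mul_inv,
    div_le_one (by positivity)]
  nlinarith [sq_nonneg (|s| - 1), sq_abs s]

theorem IsCylindrical.isC1b {E : Type*} [NormedAddCommGroup E] [InnerProductSpace ℝ E]
    {b : ℕ → E} {φ : E → ℝ} (h : IsCylindrical b φ) : IsC1b φ := by
  obtain ⟨n, ϕ, contDiff, bdd, bdd_fderiv, rfl⟩ := h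
  simpa [real_inner_comm] using IsC1b.comp_clm ⟨contDiff, bdd, bdd_fderiv⟩
    (ContinuousLinearMap.pi fun i : Fin n => innerSL ℝ (b (i + 1)))

/-! ### Gaussian measures -/

section GaussianReal

variable {v : NNReal}

theorem hasDerivAt_gaussianPDFReal (hv : v ≠ 0) (t : ℝ) :
    HasDerivAt (gaussianPDFReal 0 v) (-((v : ℝ)⁻¹ * (t * gaussianPDFReal 0 v t))) t := by
  have hv' : (v : ℝ) ≠ 0 := by exact_mod_cast hv
  have exponent : HasDerivAt (fun t : ℝ => -t ^ 2 / (2 * v)) (-(2 * t) / (2 * v)) t := by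
    simpa using (hasDerivAt_pow 2 t).neg.div_const (2 * (v : ℝ))
  simp only [gaussianPDFReal_def, sub_zero]
  convert! exponent.exp.const_mul (√(2 * π * v))⁻¹ using 1
  field_simp

theorem integrable_id_mul_gaussianPDFReal (hv : v ≠ 0) :
    Integrable fun t => t * gaussianPDFReal 0 v t := by
  have : (0 : ℝ) < v := by positivity
  have := (integrable_mul_exp_neg_mul_sq (b := (2 * (v : ℝ))⁻¹) (by positivity)).const_mul
    (√(2 * π * v))⁻¹
  refine this.congr (Eventually.of_forall fun t => ?_)
  simp only [gaussianPDFReal_def, sub_zero]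
  rw [mul_left_comm]
  congr 3
  field_simp

theorem integral_deriv_gaussianReal (hv : v ≠ 0) {u u' : ℝ → ℝ}
    (hu : ∀ t, HasDerivAt u (u' t) t) (hc : Continuous u') {C C' : ℝ} (hC : ∀ t, |u t| ≤ C)
    (hC' : ∀ t, |u' t| ≤ C') :
    ∫ t, u' t ∂gaussianReal 0 v = (v : ℝ)⁻¹ * ∫ t, t * u t ∂gaussianReal 0 v := by
  have huc : Continuous u := continuous_iff_continuousAt.2 fun t => (hu t).continuousAt
  have hpdf : Integrable (gaussianPDFReal 0 v) := integrable_gaussianPDFReal 0 v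
  have parts := integral_mul_deriv_eq_deriv_mul_of_integrable (fun t _ => hu t)
    (fun t _ => hasDerivAt_gaussianPDFReal hv t)
    (((integrable_id_mul_gaussianPDFReal hv).const_mul _).neg.bdd_mul huc.aestronglyMeasurable
      (Eventually.of_forall hC))
    (hpdf.bdd_mul hc.aestronglyMeasurable (Eventually.of_forall hC'))
    (hpdf.bdd_mul huc.aestronglyMeasurable (Eventually.of_forall hC))
  rw [integral_gaussianReal_eq_integral_smul hv, integral_gaussianReal_eq_integral_smul hv,
    ← integral_const_mul, ← neg_inj, ← integral_neg (fun t => (v : ℝ)⁻¹ * _)]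
  simp only [smul_eq_mul, mul_comm (gaussianPDFReal 0 v _) (u' _)]
  rw [← parts]
  congr 1
  ext t
  ring

end GaussianReal

namespace IsCenteredGaussian

variable {E : Type*} [NormedAddCommGroup E] [InnerProductSpace ℝ E] [MeasurableSpace E]
  {R : E →L[ℝ] E} {μ : Measure E}

theorem inner_apply_self_nonneg (hμ : IsCenteredGaussian R μ) (z : E) : 0 ≤ inner ℝ (R z) z := by
  rw [← hμ.cov]
  exact integral_nonneg fun x => mul_self_nonneg _

theorem inner_comm (hμ : IsCenteredGaussian R μ) (y z : E) :
    inner ℝ (R y) z = inner ℝ y (R z) := by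
  simp only [real_inner_comm (R z), ← hμ.cov, mul_comm]

variable [BorelSpace E]

theorem map_inner (hμ : IsCenteredGaussian R μ) (z : E) :
    μ.map (fun x => inner ℝ x z) = gaussianReal 0 (inner ℝ (R z) z).toNNReal := by
  have := hμ.isGaussian
  have functional : (fun x : E => inner ℝ x z) = innerSL ℝ z := by
    ext x; exact real_inner_comm _ _
  have mean : ∫ x, innerSL ℝ z x ∂μ = 0 := by rw [← functional]; exact hμ.mean z
  have variance : Var[innerSL ℝ z; μ] = inner ℝ (R z) z := by
    rw [variance_of_integral_eq_zero (by fun_prop) mean, ← hμ.cov z z, ← functional]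
    simp only [sq]
  rw [functional, IsGaussian.map_eq_gaussianReal, mean, variance]

theorem eLpNorm_inner (hμ : IsCenteredGaussian R μ) (z : E) (q : ℝ≥0∞) :
    eLpNorm (fun x => inner ℝ x z) q μ =
      ENNReal.ofReal √(inner ℝ (R z) z) * eLpNorm id q (gaussianReal 0 1) := by
  set σ : ℝ := √(inner ℝ (R z) z)
  have scaled : gaussianReal 0 (inner ℝ (R z) z).toNNReal =
      (gaussianReal 0 1).map (fun t => σ * t) := by
    rw [gaussianReal_map_const_mul, mul_zero, mul_one]
    congr 1
    ext
    simp [σ, Real.sq_sqrt, hμ.inner_apply_self_nonneg z]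
  calc eLpNorm (fun x => inner ℝ x z) q μ
      = eLpNorm id q (μ.map fun x => inner ℝ x z) := by
        rw [eLpNorm_map_measure (by fun_prop) (by fun_prop), Function.id_comp]
    _ = eLpNorm (σ • (id : ℝ → ℝ)) q (gaussianReal 0 1) := by
        rw [hμ.map_inner, scaled, eLpNorm_map_measure (by fun_prop) (by fun_prop)]
        rfl
    _ = ENNReal.ofReal σ * eLpNorm id q (gaussianReal 0 1) := by
        rw [eLpNorm_const_smul, Real.enorm_of_nonneg (Real.sqrt_nonneg _)]

theorem memLp_inner (hμ : IsCenteredGaussian R μ) (z : E) {q : ℝ≥0∞} (hq : q ≠ ⊤) :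
    MemLp (fun x => inner ℝ x z) q μ := by
  refine ⟨by fun_prop, ?_⟩
  rw [hμ.eLpNorm_inner]
  exact ENNReal.mul_lt_top ENNReal.ofReal_lt_top (memLp_id_gaussianReal' q hq).2

variable [CompleteSpace E] [SecondCountableTopology E] {e : E} {c : ℝ}

theorem indepFun_sub_inner_smul (hμ : IsCenteredGaussian R μ) (he : ‖e‖ = 1) (hR : R e = c • e) :
    IndepFun (fun x : E => x - inner ℝ x e • e) (fun x : E => inner ℝ x e) μ := by
  have := hμ.isGaussian
  have jointly_gaussian :
      HasGaussianLaw (fun x : E => (x - inner ℝ x e • e, inner ℝ x e)) μ := by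
    let L : E →L[ℝ] E × ℝ := (ContinuousLinearMap.id ℝ E -
      (innerSL ℝ e).smulRight e).prod (innerSL ℝ e)
    convert! (IsGaussian.hasGaussianLaw_id (μ := μ)).map L using 2
    simp [L, real_inner_comm]
  refine jointly_gaussian.indepFun_of_covariance_inner fun a b => ?_
  set a' : E := a - inner ℝ a e • e with ha'
  have inner_left (x : E) : inner ℝ a (x - inner ℝ x e • e) = inner ℝ x a' := by
    rw [ha', inner_sub_right, inner_sub_right, real_inner_smul_right, real_inner_smul_right,
      real_inner_comm x a, mul_comm]
  have inner_right (x : E) : inner ℝ b (inner ℝ x e) = b * inner ℝ x e := by simp [mul_comm]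
  have orthogonal : inner ℝ a' e = 0 := by
    rw [ha', inner_sub_left, real_inner_smul_left, real_inner_self_eq_norm_sq, he]
    ring
  simp only [inner_left, inner_right, covariance, hμ.mean, integral_const_mul, mul_zero, sub_zero,
    mul_left_comm _ b]
  rw [hμ.cov, hμ.inner_comm, hR, real_inner_smul_right, orthogonal, mul_zero, mul_zero]

theorem integral_eq_integral_line (hμ : IsCenteredGaussian R μ) (he : ‖e‖ = 1)
    (hR : R e = c • e) {g : E → ℝ} (hg : Continuous g) (hgi : Integrable g μ) :
    ∫ x, g x ∂μ =
      ∫ x, ∫ t, g (x - inner ℝ x e • e + t • e) ∂gaussianReal 0 c.toNNReal ∂μ := by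
  have := hμ.isGaussian
  set X : E → E := fun x => x - inner ℝ x e • e with hX
  set Y : E → ℝ := fun x => inner ℝ x e with hY
  have hXm : Measurable X := by rw [hX]; fun_prop
  have hYm : Measurable Y := by rw [hY]; fun_prop
  let G : E × ℝ → ℝ := fun z => g (z.1 + z.2 • e)
  have hG : Continuous G := by fun_prop
  have decompose (x : E) : G (X x, Y x) = g x := by simp [G, hX, hY]
  have law : μ.map (fun x => (X x, Y x)) = (μ.map X).prod (gaussianReal 0 c.toNNReal) := by
    rw [(indepFun_iff_map_prod_eq_prod_map_map hXm.aemeasurable hYm.aemeasurable).1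
      (hμ.indepFun_sub_inner_smul he hR), hY, hμ.map_inner, hR, real_inner_smul_left,
      real_inner_self_eq_norm_sq, he, one_pow, mul_one]
  have hGi : Integrable G (μ.map fun x => (X x, Y x)) := by
    rw [integrable_map_measure hG.aestronglyMeasurable (by fun_prop)]
    exact hgi.congr (Eventually.of_forall fun x => (decompose x).symm)
  have : IsProbabilityMeasure (μ.map X) := Measure.isProbabilityMeasure_map hXm.aemeasurable
  calc ∫ x, g x ∂μ = ∫ z, G z ∂μ.map fun x => (X x, Y x) := by
        rw [integral_map (by fun_prop) hG.aestronglyMeasurable]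
        simp only [decompose]
    _ = ∫ y, ∫ t, G (y, t) ∂gaussianReal 0 c.toNNReal ∂μ.map X := by
        rw [law] at hGi ⊢
        exact integral_prod _ hGi
    _ = _ := integral_map hXm.aemeasurable
        hG.stronglyMeasurable.integral_prod_right'.aestronglyMeasurable

/-- One-dimensional integration by parts along the line `ℝ e`, on which `μ` disintegrates because
the orthogonal component is independent of `⟨x, e⟩`. -/
theorem integral_fderiv (hμ : IsCenteredGaussian R μ) (he : ‖e‖ = 1) (hR : R e = c • e)
    (hc : 0 < c) {F : E → ℝ} (hF : IsC1b F) :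
    ∫ x, fderiv ℝ F x e ∂μ = c⁻¹ * ∫ x, inner ℝ x e * F x ∂μ := by
  have := hμ.isGaussian
  obtain ⟨C, hC⟩ := hF.bdd
  obtain ⟨C', hC'⟩ := hF.bdd_fderiv_apply e
  have hFc := hF.continuous
  have hFc' := hF.continuous_fderiv_apply e
  have inner_mul_integrable : Integrable (fun x => inner ℝ x e * F x) μ :=
    ((hμ.memLp_inner e ENNReal.one_ne_top).integrable le_rfl).mul_bdd hFc.aestronglyMeasurable
      (Eventually.of_forall hC)
  rw [hμ.integral_eq_integral_line he hR hFc' ((hF.memLp_fderiv_apply e 1).integrable le_rfl),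
    hμ.integral_eq_integral_line he hR (by fun_prop) inner_mul_integrable, ← integral_const_mul]
  congr 1
  ext x
  set y : E := x - inner ℝ x e • e with hy
  have orthogonal : inner ℝ y e = 0 := by
    rw [hy, inner_sub_left, real_inner_smul_left, real_inner_self_eq_norm_sq, he]
    ring
  have inner_line (t : ℝ) : inner ℝ (y + t • e) e = t := by
    rw [inner_add_left, orthogonal, real_inner_smul_left, real_inner_self_eq_norm_sq, he]
    ring
  have deriv_line (t : ℝ) :
      HasDerivAt (fun t => F (y + t • e)) (fderiv ℝ F (y + t • e) e) t :=
    hF.differentiable.differentiableAt.hasFDerivAt.comp_hasDerivAt t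
      (by simpa using ((hasDerivAt_id t).smul_const e).const_add y)
  simp only [inner_line]
  rw [integral_deriv_gaussianReal (Real.toNNReal_pos.2 hc).ne' deriv_line (by fun_prop)
    (fun t => hC _) (fun t => hC' _), Real.coe_toNNReal _ hc.le]

end IsCenteredGaussian

/-! ### Uniqueness of the gradient -/

section Fourier

variable {E : Type*} [NormedAddCommGroup E] [InnerProductSpace ℝ E] [MeasurableSpace E]
  {μ : Measure E}

theorem charFun_withDensity_ofReal {g : E → ℝ} (hg : Integrable g μ) (t : E) :
    charFun (μ.withDensity fun x => ENNReal.ofReal (g x)) t =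
      ∫ x, max (g x) 0 • Complex.exp (inner ℝ x t * Complex.I) ∂μ := by
  rw [charFun_apply,
    integral_withDensity_eq_integral_toReal_smul₀ hg.aemeasurable.ennreal_ofReal (by simp)]
  simp only [ENNReal.toReal_ofReal']

variable [BorelSpace E]

theorem integrable_smul_exp_inner {g : E → ℝ} (hg : Integrable g μ) (t : E) :
    Integrable (fun x => g x • Complex.exp (inner ℝ x t * Complex.I)) μ := by
  simp only [Complex.real_smul]
  refine hg.ofReal.mul_bdd (c := 1) (Continuous.aestronglyMeasurable (by fun_prop))
    (Eventually.of_forall fun x => ?_)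
  rw [Complex.norm_exp_ofReal_mul_I]

variable [CompleteSpace E] [SecondCountableTopology E]

theorem ae_eq_zero_of_integral_exp_inner_eq_zero {g : E → ℝ} (hg : Integrable g μ)
    (h : ∀ t : E, ∫ x, g x • Complex.exp (inner ℝ x t * Complex.I) ∂μ = 0) : g =ᵐ[μ] 0 := by
  have hg_neg : Integrable (fun x => -g x) μ := hg.neg
  have : IsFiniteMeasure (μ.withDensity fun x => ENNReal.ofReal (g x)) :=
    isFiniteMeasure_withDensity hg.lintegral_lt_top.ne
  have : IsFiniteMeasure (μ.withDensity fun x => ENNReal.ofReal (-g x)) :=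
    isFiniteMeasure_withDensity hg_neg.lintegral_lt_top.ne
  have densities_eq : (μ.withDensity fun x => ENNReal.ofReal (g x)) =
      μ.withDensity fun x => ENNReal.ofReal (-g x) := by
    refine Measure.ext_of_charFun (funext fun t => ?_)
    rw [charFun_withDensity_ofReal hg, charFun_withDensity_ofReal hg_neg, ← sub_eq_zero, ← h t,
      ← integral_sub (integrable_smul_exp_inner hg.pos_part t)
        (integrable_smul_exp_inner hg.neg_part t)]
    simp only [← sub_smul, max_zero_sub_max_neg_zero_eq_self]
  rw [withDensity_eq_iff hg.aemeasurable.ennreal_ofReal hg_neg.aemeasurable.ennreal_ofReal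
    hg.lintegral_lt_top.ne] at densities_eq
  filter_upwards [densities_eq] with x hx
  have parts_eq := congrArg ENNReal.toReal hx
  rw [ENNReal.toReal_ofReal', ENNReal.toReal_ofReal'] at parts_eq
  rw [← max_zero_sub_max_neg_zero_eq_self (g x), parts_eq, sub_self, Pi.zero_apply]

theorem ae_eq_zero_of_integral_mul_cos_sin_inner_eq_zero {g : E → ℝ} (hg : Integrable g μ)
    (hcos : ∀ t : E, ∫ x, g x * Real.cos (inner ℝ x t) ∂μ = 0)
    (hsin : ∀ t : E, ∫ x, g x * Real.sin (inner ℝ x t) ∂μ = 0) : g =ᵐ[μ] 0 := by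
  refine ae_eq_zero_of_integral_exp_inner_eq_zero hg fun t => ?_
  have cos_integrable : Integrable (fun x => g x * Real.cos (inner ℝ x t)) μ :=
    hg.mul_bdd (c := 1) (Continuous.aestronglyMeasurable (by fun_prop))
      (Eventually.of_forall fun x => Real.abs_cos_le_one _)
  have sin_integrable : Integrable (fun x => g x * Real.sin (inner ℝ x t)) μ :=
    hg.mul_bdd (c := 1) (Continuous.aestronglyMeasurable (by fun_prop))
      (Eventually.of_forall fun x => Real.abs_sin_le_one _)
  calc ∫ x, g x • Complex.exp (inner ℝ x t * Complex.I) ∂μ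
      = ∫ x, (((g x * Real.cos (inner ℝ x t) : ℝ) : ℂ) +
          ((g x * Real.sin (inner ℝ x t) : ℝ) : ℂ) * Complex.I) ∂μ := by
        congr 1
        ext x
        rw [Complex.exp_mul_I, Complex.real_smul]
        push_cast
        ring
    _ = 0 := by
        rw [integral_add cos_integrable.ofReal (sin_integrable.ofReal.mul_const _),
          integral_mul_const, integral_complex_ofReal, integral_complex_ofReal, hcos, hsin]
        simp

end Fourier

theorem tendsto_integral_mul_of_eLpNorm {X : Type*} [MeasurableSpace X] {μ : Measure X}
    [IsProbabilityMeasure μ] {p : ℝ≥0∞} (hp : 1 ≤ p) {h : ℕ → X → ℝ} {h' b : X → ℝ}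
    (hh : ∀ m, MemLp (h m) p μ) (hh' : MemLp h' p μ) (hb : AEStronglyMeasurable b μ)
    (hbb : ∃ C, ∀ x, |b x| ≤ C)
    (hlim : Tendsto (fun m => eLpNorm (fun x => h m x - h' x) p μ) atTop (𝓝 0)) :
    Tendsto (fun m => ∫ x, h m x * b x ∂μ) atTop (𝓝 (∫ x, h' x * b x ∂μ)) := by
  obtain ⟨C, hC⟩ := hbb
  have mul_integrable {g : X → ℝ} (hg : MemLp g p μ) : Integrable (fun x => g x * b x) μ :=
    (hg.integrable hp).mul_bdd hb (Eventually.of_forall hC)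
  refine tendsto_integral_of_L1' _ (mul_integrable hh').1
    (Eventually.of_forall fun m => mul_integrable (hh m)) ?_
  have bound_tendsto := ENNReal.Tendsto.const_mul (a := ENNReal.ofReal C) hlim
    (Or.inr ENNReal.ofReal_ne_top)
  rw [mul_zero] at bound_tendsto
  refine tendsto_of_tendsto_of_tendsto_of_le_of_le tendsto_const_nhds bound_tendsto
    (fun _ => zero_le) fun m => ?_
  calc eLpNorm ((fun x => h m x * b x) - fun x => h' x * b x) 1 μ
      ≤ ENNReal.ofReal C * eLpNorm (fun x => h m x - h' x) 1 μ := by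
        refine eLpNorm_le_mul_eLpNorm_of_ae_le_mul (Eventually.of_forall fun x => ?_) 1
        rw [Pi.sub_apply, ← sub_mul, norm_mul, mul_comm]
        exact mul_le_mul_of_nonneg_right (hC x) (norm_nonneg _)
    _ ≤ _ := by
        gcongr
        exact eLpNorm_le_eLpNorm_of_exponent_le hp ((hh m).sub hh').1

section Uniqueness

variable {E : Type*} [NormedAddCommGroup E] [InnerProductSpace ℝ E] [CompleteSpace E]
  {R S : E →L[ℝ] E} {e : E} {σ : ℝ}

theorem inner_apply_gradient (hS : ∀ x y, inner ℝ (S x) y = inner ℝ x (S y)) (hSe : S e = σ • e)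
    (φ : E → ℝ) (x : E) : inner ℝ (S (gradient φ x)) e = σ * fderiv ℝ φ x e := by
  rw [hS, hSe, real_inner_smul_right, gradient, InnerProductSpace.toDual_symm_apply]

variable [MeasurableSpace E] [BorelSpace E] [SecondCountableTopology E] {μ : Measure E}

theorem IsCenteredGaussian.integral_fderiv_mul {c : ℝ} (hμ : IsCenteredGaussian R μ)
    (he : ‖e‖ = 1) (hR : R e = c • e) (hc : 0 < c) {φ ψ : E → ℝ} (hφ : IsC1b φ) (hψ : IsC1b ψ) :
    ∫ x, fderiv ℝ φ x e * ψ x ∂μ =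
      c⁻¹ * ∫ x, φ x * (inner ℝ x e * ψ x) ∂μ - ∫ x, φ x * fderiv ℝ ψ x e ∂μ := by
  have := hμ.isGaussian
  have product_rule (x : E) : fderiv ℝ (fun x => φ x * ψ x) x e =
      φ x * fderiv ℝ ψ x e + fderiv ℝ φ x e * ψ x := by
    rw [fderiv_fun_mul hφ.differentiable.differentiableAt hψ.differentiable.differentiableAt]
    simp [mul_comm]
  have parts := hμ.integral_fderiv he hR hc (hφ.mul hψ)
  simp only [product_rule, mul_left_comm (inner ℝ _ e)] at parts
  have integral_split : ∫ x, (φ x * fderiv ℝ ψ x e + fderiv ℝ φ x e * ψ x) ∂μ =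
      ∫ x, φ x * fderiv ℝ ψ x e ∂μ + ∫ x, fderiv ℝ φ x e * ψ x ∂μ :=
    integral_add ((hφ.memLp 2).integrable_mul (hψ.memLp_fderiv_apply e 2))
      ((hφ.memLp_fderiv_apply e 2).integrable_mul (hψ.memLp 2))
  rw [← parts, integral_split, add_sub_cancel_left]

namespace HasSobolevGrad

variable {b : ℕ → E} {p : ℝ≥0∞} {u : E → ℝ} {G G' : E → E}

theorem integral_inner_mul (hG : HasSobolevGrad μ b S p u G) (hμ : IsCenteredGaussian R μ)
    (hp : 1 ≤ p) (hS : ∀ x y, inner ℝ (S x) y = inner ℝ x (S y)) (he : ‖e‖ = 1)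
    (hSe : S e = σ • e) (hσ : 0 < σ) (hR : R e = σ ^ 2 • e) {ψ : E → ℝ} (hψ : IsC1b ψ)
    (hψ' : ∃ C, ∀ x, |inner ℝ x e * ψ x| ≤ C) :
    ∫ x, inner ℝ (G x) e * ψ x ∂μ = σ * ((σ ^ 2)⁻¹ * ∫ x, u x * (inner ℝ x e * ψ x) ∂μ -
      ∫ x, u x * fderiv ℝ ψ x e ∂μ) := by
  have := hμ.isGaussian
  obtain ⟨φ, hφ, φ_tendsto, grad_tendsto⟩ := hG.approx
  have hφ' (m : ℕ) := (hφ m).isC1b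
  have hψc := hψ.continuous
  have inner_grad (m : ℕ) (x : E) := inner_apply_gradient hS hSe (φ m) x
  have inner_grad_memLp (m : ℕ) : MemLp (fun x => inner ℝ (S (gradient (φ m) x)) e) p μ := by
    simpa only [inner_grad] using ((hφ' m).memLp_fderiv_apply e p).const_mul σ
  have inner_grad_tendsto : Tendsto (fun m =>
      eLpNorm (fun x => inner ℝ (S (gradient (φ m) x)) e - inner ℝ (G x) e) p μ) atTop (𝓝 0) := by
    refine tendsto_of_tendsto_of_tendsto_of_le_of_le tendsto_const_nhds grad_tendsto
      (fun _ => zero_le) fun m => eLpNorm_mono fun x => ?_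
    rw [← inner_sub_left]
    exact (norm_inner_le_norm _ _).trans (by rw [he, mul_one])
  have φ_memLp (m : ℕ) : MemLp (φ m) p μ := (hφ' m).memLp p
  have lhs_tendsto := tendsto_integral_mul_of_eLpNorm hp inner_grad_memLp
    (hG.memLp_grad.inner_const e) hψc.aestronglyMeasurable hψ.bdd inner_grad_tendsto
  have drift_tendsto := tendsto_integral_mul_of_eLpNorm hp φ_memLp hG.memLp
    (by fun_prop) hψ' φ_tendsto
  have fderiv_tendsto := tendsto_integral_mul_of_eLpNorm hp φ_memLp hG.memLp
    (hψ.continuous_fderiv_apply e).aestronglyMeasurable (hψ.bdd_fderiv_apply e) φ_tendsto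
  refine tendsto_nhds_unique lhs_tendsto
    ((((drift_tendsto.const_mul (σ ^ 2)⁻¹).sub fderiv_tendsto).const_mul σ).congr fun m => ?_)
  rw [← hμ.integral_fderiv_mul he hR (by positivity) (hφ' m) hψ, ← integral_const_mul]
  simp only [inner_grad, mul_assoc]

theorem ae_inner_eq (hG : HasSobolevGrad μ b S p u G) (hG' : HasSobolevGrad μ b S p u G')
    (hμ : IsCenteredGaussian R μ) (hp : 1 ≤ p) (hS : ∀ x y, inner ℝ (S x) y = inner ℝ x (S y))
    (he : ‖e‖ = 1) (hSe : S e = σ • e) (hσ : 0 < σ) (hR : R e = σ ^ 2 • e) :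
    ∀ᵐ x ∂μ, inner ℝ (G x) e = inner ℝ (G' x) e := by
  have := hμ.isGaussian
  -- The weight makes `⟨x, e⟩ * weight x`, and hence the drift term of the test functions
  -- `weight * cos ⟨·, t⟩` and `weight * sin ⟨·, t⟩`, bounded.
  set weight : E → ℝ := fun x => (1 + inner ℝ x e ^ 2)⁻¹
  have hw : IsC1b weight := isC1b_inv_one_add_sq.comp_inner e
  have inner_integrable {G : E → E} (hG : HasSobolevGrad μ b S p u G) {ψ : E → ℝ}
      (hψ : IsC1b ψ) : Integrable (fun x => inner ℝ (G x) e * ψ x) μ := by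
    obtain ⟨C, hC⟩ := hψ.bdd
    exact ((hG.memLp_grad.inner_const e).integrable hp).mul_bdd
      hψ.continuous.aestronglyMeasurable (Eventually.of_forall hC)
  have orthogonal (c : ℝ → ℝ) (hc : IsC1b c) (hc1 : ∀ s, |c s| ≤ 1) (t : E) :
      ∫ x, (inner ℝ (G x) e - inner ℝ (G' x) e) * weight x * c (inner ℝ x t) ∂μ = 0 := by
    have hψ := hw.mul (hc.comp_inner t)
    have drift_bdd : ∃ C, ∀ x, |inner ℝ x e * (weight x * c (inner ℝ x t))| ≤ C := by
      refine ⟨1, fun x => ?_⟩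
      rw [← mul_assoc, abs_mul]
      exact mul_le_one₀ (abs_mul_inv_one_add_sq_le _) (abs_nonneg _) (hc1 _)
    simp only [mul_assoc, sub_mul]
    rw [integral_sub (inner_integrable hG hψ) (inner_integrable hG' hψ),
      hG.integral_inner_mul hμ hp hS he hSe hσ hR hψ drift_bdd,
      hG'.integral_inner_mul hμ hp hS he hSe hσ hR hψ drift_bdd, sub_self]
  have difference_integrable :
      Integrable (fun x => (inner ℝ (G x) e - inner ℝ (G' x) e) * weight x) μ :=
    ((inner_integrable hG hw).sub (inner_integrable hG' hw)).congr
      (Eventually.of_forall fun x => (sub_mul _ _ _).symm)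
  filter_upwards [ae_eq_zero_of_integral_mul_cos_sin_inner_eq_zero difference_integrable
    (orthogonal _ isC1b_cos Real.abs_cos_le_one) (orthogonal _ isC1b_sin Real.abs_sin_le_one)]
    with x hx
  have weight_ne_zero : weight x ≠ 0 := by positivity
  exact sub_eq_zero.1 ((mul_eq_zero.1 hx).resolve_right weight_ne_zero)

end HasSobolevGrad

end Uniqueness

/-! ### The random function `x(ξ)` -/

section OfFun

variable {X : Type*} {mX : MeasurableSpace X} {ν : Measure X} {g h : X × ℝ → ℝ} {q : ℝ≥0∞}

theorem enorm_ofFun_le (g : ℝ → ℝ) : ‖ofFun g‖ₑ ≤ ‖ofL2‖ₑ * eLpNorm g 2 vol01 := by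
  by_cases hg : MemLp g 2 vol01
  · rw [ofFun_eq_ofL2 hg, ← Lp.enorm_toLp hg]
    exact ofL2.le_opENorm _
  · simp [ofFun_of_not_memLp hg]

theorem ae_memLp_two_prodMk (hg : MemLp g q (ν.prod vol01)) (hq2 : 2 ≤ q) (hq : q ≠ ⊤) :
    ∀ᵐ x ∂ν, MemLp (fun ξ => g (x, ξ)) 2 vol01 := by
  filter_upwards [ae_memLp_prodMk hg hq] with x hx using hx.mono_exponent hq2

theorem aestronglyMeasurable_ofFun_prodMk [SFinite ν] (hg : MemLp g q (ν.prod vol01))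
    (hq2 : 2 ≤ q) (hq : q ≠ ⊤) : AEStronglyMeasurable (fun x => ofFun fun ξ => g (x, ξ)) ν := by
  refine aestronglyMeasurable_of_tendsto_ae atTop
    (f := fun n x => P n (ofFun fun ξ => g (x, ξ))) (fun n => ?_) (ae_of_all _ fun x => tendsto_P _)
  refine Finset.aestronglyMeasurable_fun_sum _ fun k hk => AEStronglyMeasurable.smul_const ?_ _
  have coeff_measurable : AEStronglyMeasurable
      (fun x => ((k * π) ^ 2)⁻¹ * ∫ ξ, g (x, ξ) * fFun k ξ ∂vol01) ν :=
    (hg.1.mul (continuous_fFun k).aestronglyMeasurable.comp_snd).integral_prod_right'.const_mul _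
  refine coeff_measurable.congr ?_
  filter_upwards [ae_memLp_two_prodMk hg hq2 hq] with x hx
  exact (inner_ofFun_f hx (Finset.mem_Icc.1 hk).1).symm

theorem eLpNorm_ofFun_sub_le (hg : MemLp g q (ν.prod vol01)) (hh : MemLp h q (ν.prod vol01))
    (hq2 : 2 ≤ q) (hq : q ≠ ⊤) :
    eLpNorm (fun x => ofFun (fun ξ => g (x, ξ)) - ofFun (fun ξ => h (x, ξ))) q ν ≤
      ‖ofL2‖ₑ * eLpNorm (g - h) q (ν.prod vol01) := by
  refine eLpNorm_le_mul_eLpNorm_prod (hg.1.sub hh.1) hq enorm_ne_top ?_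
  filter_upwards [ae_memLp_two_prodMk hg hq2 hq, ae_memLp_two_prodMk hh hq2 hq] with x hgx hhx
  rw [← ofFun_sub hgx hhx]
  refine (enorm_ofFun_le _).trans (mul_le_mul_right ?_ _)
  exact eLpNorm_le_eLpNorm_of_exponent_le hq2 (hgx.1.sub hhx.1)

theorem memLp_ofFun_prodMk [SFinite ν] (hg : MemLp g q (ν.prod vol01)) (hq2 : 2 ≤ q)
    (hq : q ≠ ⊤) : MemLp (fun x => ofFun fun ξ => g (x, ξ)) q ν := by
  refine ⟨aestronglyMeasurable_ofFun_prodMk hg hq2 hq, lt_of_le_of_lt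
    (eLpNorm_le_mul_eLpNorm_prod hg.1 hq (enorm_ne_top (x := ofL2)) ?_)
    (ENNReal.mul_lt_top enorm_lt_top hg.2)⟩
  filter_upwards [ae_memLp_prodMk hg hq] with x hx
  exact (enorm_ofFun_le _).trans
    (mul_le_mul_right (eLpNorm_le_eLpNorm_of_exponent_le hq2 hx.1) _)

end OfFun

/-- The random function `(x, ξ) ↦ P_n x(ξ)`. -/
noncomputable def partialField (n : ℕ) (z : H × ℝ) : ℝ :=
  ∑ k ∈ Finset.Icc 1 n, inner ℝ z.1 (f k) * fFun k z.2

theorem continuous_partialField (n : ℕ) : Continuous (partialField n) := by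
  have := continuous_fFun
  unfold partialField; fun_prop

theorem partialField_zero : partialField 0 = 0 := by
  ext
  simp [partialField]

theorem inner_Q_sum_smul_f {s : Finset ℕ} (hs : ∀ k ∈ s, 1 ≤ k) (c : ℕ → ℝ) :
    inner ℝ (Q (∑ k ∈ s, c k • f k)) (∑ k ∈ s, c k • f k) = ∑ k ∈ s, eig k * c k ^ 2 := by
  rw [map_sum, sum_inner]
  refine Finset.sum_congr rfl fun k hk => ?_
  rw [map_smul, Q_f (hs k hk), inner_sum, Finset.sum_eq_single_of_mem k hk]
  · simp only [real_inner_smul_left, real_inner_smul_right, inner_f_f (hs k hk) (hs k hk), if_true]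
    ring
  · intro j hj hjk
    simp only [real_inner_smul_left, real_inner_smul_right, inner_f_f (hs k hk) (hs j hj),
      if_neg hjk.symm, mul_zero]

theorem eig_mul_fFun_sq_le {k : ℕ} (hk : 1 ≤ k) (ξ : ℝ) :
    eig k * fFun k ξ ^ 2 ≤ ((k : ℝ) ^ 2)⁻¹ := by
  have : (0 : ℝ) < k := by exact_mod_cast hk
  have hπ := Real.pi_pos
  have eq : eig k * fFun k ξ ^ 2 = Real.cos (k * π * ξ) ^ 2 / π ^ 2 * ((k : ℝ) ^ 2)⁻¹ := by
    rw [eig, fFun, mul_pow, mul_pow √2, Real.sq_sqrt zero_le_two]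
    field_simp
  rw [eq]
  refine mul_le_of_le_one_left (by positivity) ((div_le_one (by positivity)).2 ?_)
  nlinarith [Real.cos_sq_le_one (k * π * ξ), Real.pi_gt_three]

theorem sum_eig_mul_fFun_sq_le {N m : ℕ} (h : N ≤ m) (n : ℕ) (ξ : ℝ) :
    ∑ k ∈ Finset.Ioc m n, eig k * fFun k ξ ^ 2 ≤ 2 / (N + 1) :=
  calc ∑ k ∈ Finset.Ioc m n, eig k * fFun k ξ ^ 2
    _ ≤ ∑ k ∈ Finset.Ioc m n, ((k : ℝ) ^ 2)⁻¹ :=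
      Finset.sum_le_sum fun k hk => eig_mul_fFun_sq_le (by grind) ξ
    _ ≤ ∑ k ∈ Finset.Ioo N (n + 1), ((k : ℝ) ^ 2)⁻¹ :=
      Finset.sum_le_sum_of_subset_of_nonneg (fun k hk => by grind) fun _ _ _ => by positivity
    _ ≤ 2 / (N + 1) := sum_Ioo_inv_sq_le N (n + 1)

theorem partialField_sub_partialField {m n : ℕ} (h : m ≤ n) (x : H) (ξ : ℝ) :
    partialField n (x, ξ) - partialField m (x, ξ) =
      inner ℝ x (∑ k ∈ Finset.Ioc m n, fFun k ξ • f k) := by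
  have split : Finset.Icc 1 n = Finset.Icc 1 m ∪ Finset.Ioc m n := by grind
  rw [partialField, partialField, split, Finset.sum_union (Finset.disjoint_left.2 (by grind)),
    add_sub_cancel_left, inner_sum]
  simp only [real_inner_smul_right, mul_comm]

/-- A version of the random function `(x, ξ) ↦ x(ξ)`: the limit of `P_n x(ξ)` in `L^q(μ × dξ)` for
all finite `q`. -/
structure IsField (μ : Measure H) (S : H × ℝ → ℝ) : Prop where
  stronglyMeasurable : StronglyMeasurable S
  memLp : ∀ q : ℝ≥0∞, q ≠ ⊤ → MemLp S q (μ.prod vol01)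
  tendsto : ∀ q : ℝ≥0∞, q ≠ ⊤ →
    Tendsto (fun n => eLpNorm (partialField n - S) q (μ.prod vol01)) atTop (𝓝 0)

section Field

variable {μ : Measure H} {q : ℝ≥0∞} {S : H × ℝ → ℝ}

theorem eLpNorm_partialField_sub_le (hμ : IsCenteredGaussian Q μ) (hq : q ≠ ⊤) {N m n : ℕ}
    (hm : N ≤ m) (hn : N ≤ n) :
    eLpNorm (partialField m - partialField n) q (μ.prod vol01) ≤
      ENNReal.ofReal √(2 / (N + 1)) * eLpNorm id q (gaussianReal 0 1) := by
  have := hμ.isGaussian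
  wlog hmn : n ≤ m generalizing m n
  · rw [eLpNorm_sub_comm]
    exact this hn hm (le_of_not_ge hmn)
  refine eLpNorm_prod_le_of_forall ((continuous_partialField m).sub
    (continuous_partialField n)).aestronglyMeasurable hq fun ξ => ?_
  simp only [Pi.sub_apply, partialField_sub_partialField hmn]
  rw [hμ.eLpNorm_inner, inner_Q_sum_smul_f (by grind)]
  gcongr
  exact sum_eig_mul_fFun_sq_le hn m ξ

theorem eLpNorm_partialField_le (hμ : IsCenteredGaussian Q μ) (hq : q ≠ ⊤) (n : ℕ) :
    eLpNorm (partialField n) q (μ.prod vol01) ≤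
      ENNReal.ofReal √2 * eLpNorm id q (gaussianReal 0 1) := by
  simpa [partialField_zero] using eLpNorm_partialField_sub_le hμ hq n.zero_le (le_refl 0)

theorem exists_eLpNorm_partialField_le (hμ : IsCenteredGaussian Q μ) (hq : q ≠ ⊤) :
    ∃ K : ℝ≥0∞, K ≠ ⊤ ∧ ∀ n, eLpNorm (partialField n) q (μ.prod vol01) ≤ K :=
  ⟨_, ENNReal.mul_ne_top ENNReal.ofReal_ne_top (memLp_id_gaussianReal' q hq).2.ne,
    eLpNorm_partialField_le hμ hq⟩

theorem memLp_partialField (hμ : IsCenteredGaussian Q μ) (hq : q ≠ ⊤) (n : ℕ) :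
    MemLp (partialField n) q (μ.prod vol01) :=
  ⟨(continuous_partialField n).aestronglyMeasurable, (eLpNorm_partialField_le hμ hq n).trans_lt
    (ENNReal.mul_lt_top ENNReal.ofReal_lt_top (memLp_id_gaussianReal' q hq).2)⟩

theorem tendsto_sqrt_mul_eLpNorm_id (hq : q ≠ ⊤) :
    Tendsto (fun N : ℕ => ENNReal.ofReal √(2 / (N + 1)) * eLpNorm id q (gaussianReal 0 1))
      atTop (𝓝 0) := by
  have lim : Tendsto (fun N : ℕ => ENNReal.ofReal √(2 / (N + 1))) atTop (𝓝 0) := by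
    have inv_tendsto : Tendsto (fun N : ℕ => 2 / ((N : ℝ) + 1)) atTop (𝓝 0) :=
      tendsto_const_nhds.div_atTop (tendsto_natCast_atTop_atTop.atTop_add tendsto_const_nhds)
    simpa using ENNReal.tendsto_ofReal inv_tendsto.sqrt
  simpa using ENNReal.Tendsto.mul_const lim (Or.inr (memLp_id_gaussianReal' q hq).2.ne)

theorem exists_isField (hμ : IsCenteredGaussian Q μ) : ∃ S, IsField μ S := by
  obtain ⟨S, hS, hbound⟩ := exists_eLpNorm_sub_le_of_cauchy
    (fun n => memLp_partialField hμ ENNReal.one_ne_top n)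
    (tendsto_sqrt_mul_eLpNorm_id ENNReal.one_ne_top)
    (fun q hq N m n hm hn => eLpNorm_partialField_sub_le hμ hq hm hn)
  refine ⟨S, hS, fun q hq => ⟨hS.aestronglyMeasurable, ?_⟩, fun q hq =>
    tendsto_of_tendsto_of_tendsto_of_le_of_le tendsto_const_nhds (tendsto_sqrt_mul_eLpNorm_id hq)
      (fun _ => zero_le) (hbound q hq)⟩
  have bound_zero := hbound q hq 0
  rw [partialField_zero, eLpNorm_sub_comm, sub_zero] at bound_zero
  exact bound_zero.trans_lt
    (ENNReal.mul_lt_top ENNReal.ofReal_lt_top (memLp_id_gaussianReal' q hq).2)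

namespace IsField

theorem tendstoInMeasure (hS : IsField μ S) :
    TendstoInMeasure (μ.prod vol01) partialField atTop S :=
  tendstoInMeasure_of_tendsto_eLpNorm one_ne_zero
    (fun n => (continuous_partialField n).aestronglyMeasurable)
    hS.stronglyMeasurable.aestronglyMeasurable (hS.tendsto 1 ENNReal.one_ne_top)

theorem ae_memLp (hS : IsField μ S) :
    ∀ᵐ x ∂μ, ∀ q : ℝ≥0∞, q ≠ ⊤ → MemLp (fun ξ => S (x, ξ)) q vol01 := by
  filter_upwards [ae_all_iff.2 fun n : ℕ =>
    ae_memLp_prodMk (hS.memLp n (ENNReal.natCast_ne_top n)) (ENNReal.natCast_ne_top n)]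
    with x hx q hq
  obtain ⟨n, hn⟩ := ENNReal.exists_nat_gt hq
  exact (hx n).mono_exponent hn.le

theorem ae_integral_eq_zero (hS : IsField μ S) (hμ : IsCenteredGaussian Q μ) :
    ∀ᵐ x ∂μ, ∫ ξ, S (x, ξ) ∂vol01 = 0 := by
  have := hμ.isGaussian
  have hS1 := memLp_one_iff_integrable.1 (hS.memLp 1 ENNReal.one_ne_top)
  have bound (n : ℕ) : eLpNorm (fun x => ∫ ξ, S (x, ξ) ∂vol01) 1 μ ≤
      eLpNorm (partialField n - S) 1 (μ.prod vol01) := by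
    have hn := memLp_one_iff_integrable.1 (memLp_partialField hμ ENNReal.one_ne_top n)
    rw [eLpNorm_sub_comm]
    refine (eLpNorm_congr_ae ?_).trans_le
      (eLpNorm_integral_le (hS1.sub hn).1 le_rfl ENNReal.one_ne_top)
    filter_upwards [hS1.prod_right_ae, hn.prod_right_ae] with x hSx hnx
    have mean_zero : ∫ ξ, partialField n (x, ξ) ∂vol01 = 0 := (represents_P n x 1).2.1
    rw [← sub_zero (∫ ξ, S (x, ξ) ∂vol01), ← mean_zero, ← integral_sub hSx hnx]
    rfl
  have norm_eq_zero : eLpNorm (fun x => ∫ ξ, S (x, ξ) ∂vol01) 1 μ = 0 :=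
    le_antisymm (ge_of_tendsto' (hS.tendsto 1 ENNReal.one_ne_top) bound) zero_le
  exact (eLpNorm_eq_zero_iff hS1.1.integral_prod_right' one_ne_zero).1 norm_eq_zero

theorem tendsto_eLpNorm_P_sub_ofFun (hS : IsField μ S) (hμ : IsCenteredGaussian Q μ) :
    Tendsto (fun n => eLpNorm (fun x => P n x - ofFun fun ξ => S (x, ξ)) 2 μ) atTop (𝓝 0) := by
  have := hμ.isGaussian
  have lim := ENNReal.Tendsto.const_mul (a := ‖ofL2‖ₑ) (hS.tendsto 2 ENNReal.ofNat_ne_top)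
    (Or.inr enorm_ne_top)
  rw [mul_zero] at lim
  refine tendsto_of_tendsto_of_tendsto_of_le_of_le tendsto_const_nhds lim (fun _ => zero_le)
    fun n => ?_
  have eq : (fun x => P n x - ofFun fun ξ => S (x, ξ)) =
      fun x => ofFun (fun ξ => partialField n (x, ξ)) - ofFun fun ξ => S (x, ξ) :=
    funext fun x => congrArg (· - _) (P_eq_ofFun n x)
  rw [eq]
  exact eLpNorm_ofFun_sub_le (memLp_partialField hμ ENNReal.ofNat_ne_top n)
    (hS.memLp 2 ENNReal.ofNat_ne_top) le_rfl ENNReal.ofNat_ne_top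

theorem ae_eq_ofFun (hS : IsField μ S) (hμ : IsCenteredGaussian Q μ) :
    ∀ᵐ x ∂μ, x = ofFun fun ξ => S (x, ξ) := by
  have := hμ.isGaussian
  have P_measurable (n : ℕ) : AEStronglyMeasurable (P n) μ := (continuous_P n).aestronglyMeasurable
  have section_measurable := aestronglyMeasurable_ofFun_prodMk
    (hS.memLp 2 ENNReal.ofNat_ne_top) le_rfl ENNReal.ofNat_ne_top
  exact tendstoInMeasure_ae_unique
    (tendstoInMeasure_of_tendsto_ae P_measurable (ae_of_all _ tendsto_P))
    (tendstoInMeasure_of_tendsto_eLpNorm two_ne_zero P_measurable section_measurable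
      (hS.tendsto_eLpNorm_P_sub_ofFun hμ))

theorem ae_represents (hS : IsField μ S) (hμ : IsCenteredGaussian Q μ) :
    ∀ᵐ x ∂μ, ∀ q : ℝ≥0∞, q ≠ ⊤ → Represents q (fun ξ => S (x, ξ)) x := by
  filter_upwards [hS.ae_memLp, hS.ae_integral_eq_zero hμ, hS.ae_eq_ofFun hμ] with x hx h0 hxS q hq
  have h := represents_ofFun (hx q hq) (hx 2 ENNReal.ofNat_ne_top) h0
  rwa [← hxS] at h

end IsField

end Field

/-! ### Smooth truncation -/

/-- A bounded odd truncation at level `1 / ε`, which equals `sin (ε t) / ε` for `ε ≠ 0` and `t` for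
`ε = 0`. -/
noncomputable def trunc (ε t : ℝ) : ℝ := t * Real.sinc (ε * t)

theorem trunc_zero (t : ℝ) : trunc 0 t = t := by simp [trunc]

theorem mul_trunc (ε t : ℝ) : ε * trunc ε t = Real.sin (ε * t) := by
  rcases eq_or_ne (ε * t) 0 with h | h
  · rw [trunc, ← mul_assoc, h, zero_mul, Real.sin_zero]
  · rw [trunc, ← mul_assoc, Real.sinc_of_ne_zero h, mul_div_cancel₀ _ h]

theorem continuous_trunc : Continuous fun p : ℝ × ℝ => trunc p.1 p.2 :=
  continuous_snd.mul (Real.continuous_sinc.comp (continuous_fst.mul continuous_snd))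

theorem hasDerivAt_trunc (ε t : ℝ) : HasDerivAt (trunc ε) (Real.cos (ε * t)) t := by
  rcases eq_or_ne ε 0 with rfl | hε
  · simpa [funext trunc_zero] using hasDerivAt_id' t
  have eq : trunc ε = fun t => ε⁻¹ * Real.sin (ε * t) :=
    funext fun t => by rw [← mul_trunc, inv_mul_cancel_left₀ hε]
  have deriv_sin := (((hasDerivAt_id t).const_mul ε).sin).const_mul ε⁻¹
  simpa [eq, hε, mul_comm, mul_left_comm] using deriv_sin

theorem abs_trunc_le (ε t : ℝ) : |trunc ε t| ≤ |t| := by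
  rw [trunc, abs_mul]
  exact mul_le_of_le_one_right (abs_nonneg t) (Real.abs_sinc_le_one _)

theorem abs_trunc_le_inv {ε : ℝ} (hε : 0 < ε) (t : ℝ) : |trunc ε t| ≤ ε⁻¹ := by
  rw [← one_div, le_div_iff₀' hε, ← abs_of_pos hε, ← abs_mul, abs_of_pos hε, mul_trunc]
  exact Real.abs_sin_le_one _

/-- `Φ` is a `C¹` function such that `|Φ|` and `|Φ'|` are bounded by `A (1 + |t|^r)`. -/
structure IsC1OfGrowth (Φ : ℝ → ℝ) (A r : ℝ) : Prop where
  contDiff : ContDiff ℝ 1 Φ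
  pos : 0 < r
  abs_apply_le : ∀ t, |Φ t| ≤ A * (1 + |t| ^ r)
  abs_deriv_le : ∀ t, |deriv Φ t| ≤ A * (1 + |t| ^ r)

theorem abs_rpow_le_one_add {a b : ℝ} (ha : 0 ≤ a) (hab : a ≤ b) (t : ℝ) :
    |t| ^ a ≤ 1 + |t| ^ b := by
  rcases le_total |t| 1 with ht | ht
  · linarith [Real.rpow_le_one (abs_nonneg t) ht ha, Real.rpow_nonneg (abs_nonneg t) b]
  · linarith [Real.rpow_le_rpow_of_exponent_le ht hab]

theorem abs_sub_zero_le_of_abs_deriv_le {Φ : ℝ → ℝ} {C p : ℝ} (hΦ : Differentiable ℝ Φ)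
    (hC : 0 ≤ C) (hp : 0 ≤ p) (h : ∀ t, |deriv Φ t| ≤ C * (1 + |t| ^ p)) (t : ℝ) :
    |Φ t - Φ 0| ≤ C * (1 + |t| ^ p) * |t| := by
  have deriv_le (s : ℝ) (hs : s ∈ Metric.closedBall 0 |t|) :
      ‖deriv Φ s‖ ≤ C * (1 + |t| ^ p) := by
    have hst : |s| ≤ |t| := by simpa using hs
    exact (h s).trans (by gcongr)
  simpa using Convex.norm_image_sub_le_of_norm_deriv_le (fun s _ => hΦ s) deriv_le
    (convex_closedBall 0 |t|) (Metric.mem_closedBall_self (abs_nonneg t)) (by simp)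

theorem IsC1OfGrowth.of_abs_deriv_le {Φ : ℝ → ℝ} {C p : ℝ} (hΦ : ContDiff ℝ 1 Φ) (hp : 0 ≤ p)
    (h : ∀ t, |deriv Φ t| ≤ C * (1 + |t| ^ p)) :
    IsC1OfGrowth Φ (|Φ 0| + 2 * C) (p + 1) := by
  have hC : 0 ≤ C := by
    have := (abs_nonneg _).trans (h 0)
    exact nonneg_of_mul_nonneg_left this (by positivity)
  refine ⟨hΦ, by positivity, fun t => ?_, fun t => ?_⟩
  · have increment :=
      abs_sub_zero_le_of_abs_deriv_le (hΦ.differentiable one_ne_zero) hC hp h t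
    have linear := abs_rpow_le_one_add zero_le_one (le_add_of_nonneg_left hp) t
    have power : |t| ^ (p + 1) = |t| ^ p * |t| := by
      rw [Real.rpow_add_one' (abs_nonneg t) (by positivity)]
    rw [Real.rpow_one] at linear
    nlinarith [abs_sub_abs_le_abs_sub (Φ t) (Φ 0), mul_le_mul_of_nonneg_left linear hC,
      mul_nonneg (abs_nonneg (Φ 0)) (Real.rpow_nonneg (abs_nonneg t) (p + 1)), abs_nonneg (Φ 0)]
  · have power := abs_rpow_le_one_add hp (le_add_of_nonneg_right zero_le_one) t
    have nonneg := Real.rpow_nonneg (abs_nonneg t) (p + 1)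
    nlinarith [h t, mul_le_mul_of_nonneg_left power hC, mul_nonneg (abs_nonneg (Φ 0)) nonneg,
      mul_nonneg hC nonneg, abs_nonneg (Φ 0)]

namespace IsC1OfGrowth

variable {Φ : ℝ → ℝ} {A r : ℝ}

theorem hasDerivAt_comp_trunc (hΦ : IsC1OfGrowth Φ A r) (ε t : ℝ) :
    HasDerivAt (fun t => Φ (trunc ε t)) (deriv Φ (trunc ε t) * Real.cos (ε * t)) t :=
  (hΦ.contDiff.differentiable one_ne_zero).differentiableAt.hasDerivAt.comp t (hasDerivAt_trunc ε t)

theorem deriv_comp_trunc (hΦ : IsC1OfGrowth Φ A r) (ε : ℝ) :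
    deriv (fun t => Φ (trunc ε t)) = fun t => deriv Φ (trunc ε t) * Real.cos (ε * t) :=
  funext fun t => (hΦ.hasDerivAt_comp_trunc ε t).deriv

theorem continuous_comp_trunc (hΦ : IsC1OfGrowth Φ A r) :
    Continuous fun p : ℝ × ℝ => Φ (trunc p.1 p.2) :=
  hΦ.contDiff.continuous.comp continuous_trunc

theorem continuous_deriv_comp_trunc (hΦ : IsC1OfGrowth Φ A r) :
    Continuous fun p : ℝ × ℝ => deriv (fun t => Φ (trunc p.1 t)) p.2 := by
  simp only [hΦ.deriv_comp_trunc]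
  exact ((hΦ.contDiff.continuous_deriv le_rfl).comp continuous_trunc).mul (by fun_prop)

theorem comp_trunc (hΦ : IsC1OfGrowth Φ A r) (ε : ℝ) :
    IsC1OfGrowth (fun t => Φ (trunc ε t)) A r := by
  have hA : 0 ≤ A := by
    simpa [Real.zero_rpow hΦ.pos.ne'] using (abs_nonneg _).trans (hΦ.abs_apply_le 0)
  have growth (t : ℝ) : A * (1 + |trunc ε t| ^ r) ≤ A * (1 + |t| ^ r) := by
    have := abs_trunc_le ε t
    have := hΦ.pos
    gcongr
  refine ⟨contDiff_one_iff_deriv.2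
    ⟨fun t => (hΦ.hasDerivAt_comp_trunc ε t).differentiableAt, ?_⟩, hΦ.pos,
    fun t => (hΦ.abs_apply_le _).trans (growth t), fun t => ?_⟩
  · exact hΦ.continuous_deriv_comp_trunc.comp (Continuous.prodMk_right ε)
  · rw [hΦ.deriv_comp_trunc, abs_mul]
    exact (mul_le_of_le_one_right (abs_nonneg _) (Real.abs_cos_le_one _)).trans
      ((hΦ.abs_deriv_le _).trans (growth t))

theorem isC1b_comp_trunc (hΦ : IsC1OfGrowth Φ A r) {ε : ℝ} (hε : 0 < ε) :
    IsC1b fun t => Φ (trunc ε t) := by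
  have mem (t : ℝ) : trunc ε t ∈ Icc (-ε⁻¹) ε⁻¹ := abs_le.1 (abs_trunc_le_inv hε t)
  obtain ⟨C, hC⟩ := isCompact_Icc.exists_bound_of_continuousOn (s := Icc (-ε⁻¹) ε⁻¹)
    hΦ.contDiff.continuous.continuousOn
  obtain ⟨C', hC'⟩ := isCompact_Icc.exists_bound_of_continuousOn (s := Icc (-ε⁻¹) ε⁻¹)
    (hΦ.contDiff.continuous_deriv le_rfl).continuousOn
  refine .of_deriv (hΦ.comp_trunc ε).contDiff (fun t => hC _ (mem t)) (C' := C') fun t => ?_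
  rw [hΦ.deriv_comp_trunc, abs_mul]
  exact (mul_le_of_le_one_right (abs_nonneg _) (Real.abs_cos_le_one _)).trans (hC' _ (mem t))

end IsC1OfGrowth

/-! ### Cylindrical approximations -/

section IntegralFunctional

variable {X E : Type*} {mX : MeasurableSpace X} {ν : Measure X} [IsFiniteMeasure ν]
  [NormedAddCommGroup E] [NormedSpace ℝ E] {F : ℝ → ℝ} {L : X → E →L[ℝ] ℝ}

theorem hasFDerivAt_integral_comp (hF : IsC1b F) (hL : Integrable L ν) (y : E) :
    HasFDerivAt (fun y => ∫ ξ, F (L ξ y) ∂ν) (∫ ξ, deriv F (L ξ y) • L ξ ∂ν) y := by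
  obtain ⟨C₀, hC₀⟩ := hF.bdd
  obtain ⟨C, hC⟩ := hF.bdd_fderiv
  have measurable (y : E) : AEStronglyMeasurable (fun ξ => L ξ y) ν :=
    hL.1.apply_continuousLinearMap y
  refine hasFDerivAt_integral_of_dominated_of_fderiv_le (s := univ)
    (F' := fun y ξ => deriv F (L ξ y) • L ξ) (bound := fun ξ => C * ‖L ξ‖) univ_mem
    (Eventually.of_forall fun y => hF.continuous.comp_aestronglyMeasurable (measurable y))
    (.of_bound (hF.continuous.comp_aestronglyMeasurable (measurable y)) C₀
      (ae_of_all _ fun ξ => hC₀ _))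
    (((hF.contDiff.continuous_deriv le_rfl).comp_aestronglyMeasurable (measurable y)).smul hL.1)
    (ae_of_all _ fun ξ y _ => ?_) (hL.norm.const_mul C) (ae_of_all _ fun ξ y _ => ?_)
  · rw [norm_smul, norm_deriv_eq_norm_fderiv]
    exact mul_le_mul_of_nonneg_right (hC _) (norm_nonneg _)
  · exact hF.differentiable.differentiableAt.hasDerivAt.comp_hasFDerivAt y (L ξ).hasFDerivAt

theorem isC1b_integral_comp (hF : IsC1b F) (hL : Integrable L ν) :
    IsC1b fun y => ∫ ξ, F (L ξ y) ∂ν := by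
  obtain ⟨C₀, hC₀⟩ := hF.bdd
  obtain ⟨C, hC⟩ := hF.bdd_fderiv
  have deriv_continuous := hF.contDiff.continuous_deriv le_rfl
  have bound (y : E) : ∀ᵐ ξ ∂ν, ‖deriv F (L ξ y) • L ξ‖ ≤ C * ‖L ξ‖ := ae_of_all _ fun ξ => by
    rw [norm_smul, norm_deriv_eq_norm_fderiv]
    exact mul_le_mul_of_nonneg_right (hC _) (norm_nonneg _)
  have fderiv_eq : fderiv ℝ (fun y => ∫ ξ, F (L ξ y) ∂ν) =
      fun y => ∫ ξ, deriv F (L ξ y) • L ξ ∂ν :=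
    funext fun y => (hasFDerivAt_integral_comp hF hL y).fderiv
  refine ⟨contDiff_one_iff_fderiv.2
    ⟨fun y => (hasFDerivAt_integral_comp hF hL y).differentiableAt, ?_⟩,
    ⟨C₀ * ν.real univ, fun y =>
      norm_integral_le_of_norm_le_const (f := fun ξ => F (L ξ y)) (ae_of_all _ fun ξ => hC₀ _)⟩,
    ⟨∫ ξ, C * ‖L ξ‖ ∂ν, fun y => ?_⟩⟩
  · rw [fderiv_eq]
    refine continuous_of_dominated (fun y => ?_) bound (hL.norm.const_mul C)
      (ae_of_all _ fun ξ => ?_)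
    · exact (deriv_continuous.comp_aestronglyMeasurable
        (hL.1.apply_continuousLinearMap y)).smul hL.1
    · exact (deriv_continuous.comp (L ξ).continuous).smul continuous_const
  · rw [fderiv_eq]
    exact norm_integral_le_of_norm_le (hL.norm.const_mul C) (bound y)

end IntegralFunctional

theorem integrable_sum_fFun_smul {ι E : Type*} [NormedAddCommGroup E] [NormedSpace ℝ E]
    (s : Finset ι) (k : ι → ℕ) (v : ι → E) :
    Integrable (fun ξ => ∑ i ∈ s, fFun (k i) ξ • v i) vol01 :=
  integrable_finsetSum _ fun i _ => (integrable_of_continuous (continuous_fFun (k i))).smul_const _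

/-- The element `2^{-1/2} Φ'(S(x, ·))` of `H`. When `S(x, ·)` represents `x`, this is
`Q^{1/2} DU(x)`: the gradient of `U` in `H` is `B` applied to `Φ'(x(·))`, and
`Q^{1/2} = 2^{-1/2} B⁻¹`. -/
noncomputable def gradU (Φ : ℝ → ℝ) (S : H × ℝ → ℝ) (x : H) : H :=
  (√2)⁻¹ • ofFun fun ξ => deriv Φ (S (x, ξ))

theorem inner_gradU {Φ : ℝ → ℝ} {S : H × ℝ → ℝ} {x : H}
    (hx : MemLp (fun ξ => deriv Φ (S (x, ξ))) 2 vol01) {k : ℕ} (hk : 1 ≤ k) :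
    inner ℝ (gradU Φ S x) (f k) = √(eig k) * ∫ ξ, deriv Φ (S (x, ξ)) * fFun k ξ ∂vol01 := by
  rw [gradU, real_inner_smul_left, inner_ofFun_f hx hk, sqrt_eig, mul_assoc]

section Un

variable {F : ℝ → ℝ}

theorem partialField_eq_sum_fin (n : ℕ) (z : H × ℝ) :
    partialField n z = ∑ i : Fin n, inner ℝ z.1 (f (i + 1)) * fFun (i + 1) z.2 := by
  rw [← Finset.sum_range fun i => inner ℝ z.1 (f (i + 1)) * fFun (i + 1) z.2, Finset.range_eq_Ico,
    Finset.sum_Ico_add' (fun k => inner ℝ z.1 (f k) * fFun k z.2) 0 n 1]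
  rfl

theorem isCylindrical_Un (hF : IsC1b F) (n : ℕ) : IsCylindrical f (Un F n) := by
  have h := isC1b_integral_comp hF (integrable_sum_fFun_smul Finset.univ
    (fun i : Fin n => (i : ℕ) + 1)
    fun i => ContinuousLinearMap.proj (R := ℝ) (φ := fun _ : Fin n => ℝ) i)
  refine ⟨n, _, h.contDiff, h.bdd, h.bdd_fderiv, funext fun x => integral_congr_ae <|
    ae_of_all _ fun ξ => congrArg F <| (partialField_eq_sum_fin n (x, ξ)).trans ?_⟩
  simp only [sum_apply, _root_.smul_apply, ContinuousLinearMap.proj_apply, smul_eq_mul, mul_comm]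

theorem partialField_f {k : ℕ} (hk : 1 ≤ k) (n : ℕ) (ξ : ℝ) :
    partialField n (f k, ξ) = if k ≤ n then fFun k ξ else 0 := by
  have coeff : ∀ j ∈ Finset.Icc 1 n,
      inner ℝ (f k) (f j) * fFun j ξ = if k = j then fFun j ξ else 0 := fun j hj => by
    rw [inner_f_f hk (Finset.mem_Icc.1 hj).1, ite_mul, one_mul, zero_mul]
  rw [partialField, Finset.sum_congr rfl coeff, Finset.sum_ite_eq]
  simp only [Finset.mem_Icc, hk, true_and]

theorem fderiv_Un_apply (hF : IsC1b F) (n : ℕ) (x v : H) :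
    fderiv ℝ (Un F n) x v =
      ∫ ξ, deriv F (partialField n (x, ξ)) * partialField n (v, ξ) ∂vol01 := by
  let L (ξ : ℝ) : H →L[ℝ] ℝ := ∑ k ∈ Finset.Icc 1 n, fFun k ξ • innerSL ℝ (f k)
  have L_apply (ξ : ℝ) (x : H) : L ξ x = partialField n (x, ξ) := by
    simp [L, partialField, real_inner_comm, mul_comm]
  have hL : Integrable L vol01 := integrable_sum_fFun_smul _ _ _
  obtain ⟨C, hC⟩ := hF.bdd_fderiv
  have integrable : Integrable (fun ξ => deriv F (L ξ x) • L ξ) vol01 :=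
    hL.bdd_smul C ((hF.contDiff.continuous_deriv le_rfl).comp_aestronglyMeasurable
      (hL.1.apply_continuousLinearMap x))
      (ae_of_all _ fun ξ => norm_deriv_eq_norm_fderiv.trans_le (hC _))
  have Un_eq : Un F n = fun x => ∫ ξ, F (L ξ x) ∂vol01 := by simp only [L_apply]; rfl
  rw [Un_eq, (hasFDerivAt_integral_comp hF hL x).fderiv,
    ContinuousLinearMap.integral_apply integrable]
  simp only [_root_.smul_apply, L_apply, smul_eq_mul]

theorem Qhalf_gradient_Un (hF : IsC1b F) (n : ℕ) (x : H) :
    Qhalf (gradient (Un F n) x) = P n (gradU F (partialField n) x) := by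
  have deriv_continuous : Continuous fun ξ => deriv F (partialField n (x, ξ)) :=
    (hF.contDiff.continuous_deriv le_rfl).comp
      ((continuous_partialField n).comp (Continuous.prodMk_right x))
  refine eq_of_inner_f_eq fun k hk => ?_
  rw [inner_apply_gradient (fun x y => Qhalf_isPositive.1 x y) (Qhalf_f hk), fderiv_Un_apply hF,
    inner_P_f hk, inner_gradU (memLp_of_continuous deriv_continuous 2) hk]
  simp only [partialField_f hk]
  split_ifs
  · rfl
  · simp only [mul_zero, integral_zero]

end Un

/-! ### Convergence of the approximations -/

theorem tendsto_eLpNorm_sub_of_norm_le {X E : Type*} {mX : MeasurableSpace X} {ν : Measure X}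
    [IsFiniteMeasure ν] [NormedAddCommGroup E] {q : ℝ≥0∞} (hq1 : 1 ≤ q) (hq : q ≠ ⊤)
    {F : ℕ → X → E} {G : X → E} (hF : ∀ n, AEStronglyMeasurable (F n) ν) (hG : MemLp G q ν)
    (hle : ∀ n x, ‖F n x‖ ≤ ‖G x‖) (hlim : ∀ᵐ x ∂ν, Tendsto (fun n => F n x) atTop (𝓝 (G x))) :
    Tendsto (fun n => eLpNorm (F n - G) q ν) atTop (𝓝 0) := by
  refine tendsto_Lp_finite_of_tendsto_ae hq1 hq hF hG (fun ε hε => ?_) hlim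
  obtain ⟨δ, hδ, hGδ⟩ := hG.eLpNorm_indicator_le hq1 hq hε
  refine ⟨δ, hδ, fun n s hs hνs => (eLpNorm_mono fun x => ?_).trans (hGδ s hs hνs)⟩
  simp only [norm_indicator_eq_indicator_norm]
  exact indicator_le_indicator (hle n x)

theorem tendsto_eLpNorm_P_comp_sub {X : Type*} {mX : MeasurableSpace X} {ν : Measure X}
    [IsFiniteMeasure ν] {q : ℝ≥0∞} (hq1 : 1 ≤ q) (hq : q ≠ ⊤) {F : ℕ → X → H} {G : X → H}
    (hF : ∀ n, AEStronglyMeasurable (F n) ν) (hG : MemLp G q ν)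
    (hlim : Tendsto (fun n => eLpNorm (F n - G) q ν) atTop (𝓝 0)) :
    Tendsto (fun n => eLpNorm (fun x => P n (F n x) - G x) q ν) atTop (𝓝 0) := by
  have P_measurable (n : ℕ) {T : X → H} (hT : AEStronglyMeasurable T ν) :
      AEStronglyMeasurable (fun x => P n (T x)) ν :=
    (continuous_P n).comp_aestronglyMeasurable hT
  have P_lim := tendsto_eLpNorm_sub_of_norm_le hq1 hq (fun n => P_measurable n hG.1) hG
    (fun n x => norm_P_le n (G x)) (ae_of_all _ fun x => tendsto_P (G x))
  have lim := hlim.add P_lim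
  rw [add_zero] at lim
  refine tendsto_of_tendsto_of_tendsto_of_le_of_le tendsto_const_nhds lim (fun _ => zero_le)
    fun n => ?_
  have split : (fun x => P n (F n x) - G x) =
      (fun x => P n (F n x - G x)) + ((fun x => P n (G x)) - G) := by
    ext1 x
    simp only [Pi.add_apply, Pi.sub_apply, P, inner_sub_left, sub_smul, Finset.sum_sub_distrib]
    abel
  rw [split]
  refine (eLpNorm_add_le (P_measurable n ((hF n).sub hG.1)) ((P_measurable n hG.1).sub hG.1)
    hq1).trans (add_le_add_left (eLpNorm_mono fun x => norm_P_le n _) _)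

namespace HasSobolevGrad

variable {E : Type*} [NormedAddCommGroup E] [InnerProductSpace ℝ E] [CompleteSpace E]
  [MeasurableSpace E] {μ : Measure E} {b : ℕ → E} {S : E →L[ℝ] E} {p q : ℝ≥0∞} {u v : E → ℝ}
  {G : E → E}

theorem congr (h : HasSobolevGrad μ b S p u G) (huv : u =ᵐ[μ] v) : HasSobolevGrad μ b S p v G := by
  obtain ⟨φ, hφ, u_lim, grad_lim⟩ := h.approx
  refine ⟨h.memLp.ae_eq huv, h.memLp_grad, φ, hφ, u_lim.congr fun m => eLpNorm_congr_ae ?_,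
    grad_lim⟩
  filter_upwards [huv] with x hx
  rw [hx]

theorem mono [BorelSpace E] [SecondCountableTopology E] [IsProbabilityMeasure μ]
    (h : HasSobolevGrad μ b S q u G) (hpq : p ≤ q) : HasSobolevGrad μ b S p u G := by
  obtain ⟨φ, hφ, u_lim, grad_lim⟩ := h.approx
  refine ⟨h.memLp.mono_exponent hpq, h.memLp_grad.mono_exponent hpq, φ, hφ,
    tendsto_of_tendsto_of_tendsto_of_le_of_le tendsto_const_nhds u_lim (fun _ => zero_le)
      fun m => eLpNorm_le_eLpNorm_of_exponent_le hpq ?_,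
    tendsto_of_tendsto_of_tendsto_of_le_of_le tendsto_const_nhds grad_lim (fun _ => zero_le)
      fun m => eLpNorm_le_eLpNorm_of_exponent_le hpq ?_⟩
  · exact (hφ m).isC1b.continuous.aestronglyMeasurable.sub h.memLp.1
  · have gradient_continuous : Continuous (gradient (φ m)) :=
      (InnerProductSpace.toDual ℝ E).symm.continuous.comp
        ((hφ m).isC1b.contDiff.continuous_fderiv one_ne_zero)
    exact (S.continuous.comp gradient_continuous).aestronglyMeasurable.sub h.memLp_grad.1

end HasSobolevGrad

theorem memLp_gradU {μ : Measure H} [SFinite μ] {Φ : ℝ → ℝ} {S : H × ℝ → ℝ} {q : ℝ≥0∞}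
    (h : MemLp (fun z => deriv Φ (S z)) q (μ.prod vol01)) (hq2 : 2 ≤ q) (hq : q ≠ ⊤) :
    MemLp (gradU Φ S) q μ :=
  (memLp_ofFun_prodMk h hq2 hq).const_smul (√2)⁻¹

theorem eLpNorm_gradU_sub_le {μ : Measure H} {Φ Ψ : ℝ → ℝ} {S T : H × ℝ → ℝ} {q : ℝ≥0∞}
    (hΦ : MemLp (fun z => deriv Φ (S z)) q (μ.prod vol01))
    (hΨ : MemLp (fun z => deriv Ψ (T z)) q (μ.prod vol01)) (hq2 : 2 ≤ q) (hq : q ≠ ⊤) :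
    eLpNorm (gradU Φ S - gradU Ψ T) q μ ≤
      ‖(√2)⁻¹‖ₑ * (‖ofL2‖ₑ *
        eLpNorm (fun z => deriv Φ (S z) - deriv Ψ (T z)) q (μ.prod vol01)) := by
  have eq : gradU Φ S - gradU Ψ T = (√2)⁻¹ • fun x =>
      ofFun (fun ξ => deriv Φ (S (x, ξ))) - ofFun fun ξ => deriv Ψ (T (x, ξ)) :=
    funext fun x => (smul_sub _ _ _).symm
  rw [eq, eLpNorm_const_smul]
  exact mul_le_mul_right (eLpNorm_ofFun_sub_le hΦ hΨ hq2 hq) _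

theorem eLpNorm_integral_sub_le {X Y : Type*} {mX : MeasurableSpace X} {mY : MeasurableSpace Y}
    {μ : Measure X} {ρ : Measure Y} [IsProbabilityMeasure ρ] {q : ℝ≥0∞} {g h : X × Y → ℝ}
    (hg : MemLp g q (μ.prod ρ)) (hh : MemLp h q (μ.prod ρ)) (hq1 : 1 ≤ q) (hq : q ≠ ⊤) :
    eLpNorm (fun x => ∫ y, g (x, y) ∂ρ - ∫ y, h (x, y) ∂ρ) q μ ≤ eLpNorm (g - h) q (μ.prod ρ) := by
  refine le_trans (le_of_eq (eLpNorm_congr_ae ?_)) (eLpNorm_integral_le (hg.sub hh).1 hq1 hq)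
  filter_upwards [ae_memLp_prodMk hg hq, ae_memLp_prodMk hh hq] with x hgx hhx
  exact (integral_sub (hgx.integrable hq1) (hhx.integrable hq1)).symm

theorem memLp_comp_partialField {μ : Measure H} (hμ : IsCenteredGaussian Q μ) {F : ℝ → ℝ} {A r : ℝ}
    {q : ℝ≥0∞} (hFc : Continuous F) (hr : 0 < r) (hF : ∀ t, |F t| ≤ A * (1 + |t| ^ r))
    (hq1 : 1 ≤ q) (hq : q ≠ ⊤) (n : ℕ) :
    MemLp (fun z => F (partialField n z)) q (μ.prod vol01) := by
  have := hμ.isGaussian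
  exact memLp_comp (fun q hq => memLp_partialField hμ hq n) hFc hr hF hq1 hq

theorem memLp_Un {μ : Measure H} (hμ : IsCenteredGaussian Q μ) {F : ℝ → ℝ} {A r : ℝ} {q : ℝ≥0∞}
    (hFc : Continuous F) (hr : 0 < r) (hF : ∀ t, |F t| ≤ A * (1 + |t| ^ r)) (hq1 : 1 ≤ q)
    (hq : q ≠ ⊤) (n : ℕ) : MemLp (Un F n) q μ := by
  have := hμ.isGaussian
  exact memLp_integral (memLp_comp_partialField hμ hFc hr hF hq1 hq n) hq1 hq

namespace IsField

variable {μ : Measure H} {S : H × ℝ → ℝ} {q : ℝ≥0∞}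

theorem ae_U_eq (hS : IsField μ S) (hμ : IsCenteredGaussian Q μ) (Φ : ℝ → ℝ) {p₂ : ℝ}
    (hp : 0 ≤ p₂) : ∀ᵐ x ∂μ, U Φ p₂ x = ((∫ ξ, Φ (S (x, ξ)) ∂vol01 : ℝ) : EReal) := by
  filter_upwards [hS.ae_represents hμ] with x hx
  exact U_eq_of_represents hp (hx _ ENNReal.ofReal_ne_top)

theorem ae_toFun_eq (hS : IsField μ S) (hμ : IsCenteredGaussian Q μ) :
    ∀ᵐ x ∂μ, toFun x =ᵐ[vol01] fun ξ => S (x, ξ) := by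
  filter_upwards [hS.ae_represents hμ] with x hx using toFun_ae_eq (hx 1 ENNReal.one_ne_top)

section Growth

variable {Λ : Type*} [TopologicalSpace Λ] {F : Λ → ℝ → ℝ} {A r : ℝ} {a : ℕ → Λ} {a' : Λ}

theorem tendsto_eLpNorm_comp_partialField_sub (hS : IsField μ S) (hμ : IsCenteredGaussian Q μ)
    (hFc : Continuous fun p : Λ × ℝ => F p.1 p.2) (hr : 0 < r)
    (hF : ∀ a t, |F a t| ≤ A * (1 + |t| ^ r)) (ha : Tendsto a atTop (𝓝 a')) (hq1 : 1 ≤ q)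
    (hq : q ≠ ⊤) :
    Tendsto (fun n => eLpNorm (fun z => F (a n) (partialField n z) - F a' (S z)) q (μ.prod vol01))
      atTop (𝓝 0) := by
  have := hμ.isGaussian
  exact tendsto_eLpNorm_comp_sub (fun n => (continuous_partialField n).aestronglyMeasurable)
    (fun q hq => exists_eLpNorm_partialField_le hμ hq) hS.memLp hS.tendstoInMeasure hFc hr hF ha
    hq1 hq

theorem tendsto_eLpNorm_Un_sub (hS : IsField μ S) (hμ : IsCenteredGaussian Q μ)
    (hFc : Continuous fun p : Λ × ℝ => F p.1 p.2) (hr : 0 < r)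
    (hF : ∀ a t, |F a t| ≤ A * (1 + |t| ^ r)) (ha : Tendsto a atTop (𝓝 a')) (hq1 : 1 ≤ q)
    (hq : q ≠ ⊤) :
    Tendsto (fun n => eLpNorm (fun x => Un (F (a n)) n x - ∫ ξ, F a' (S (x, ξ)) ∂vol01) q μ)
      atTop (𝓝 0) := by
  have := hμ.isGaussian
  have continuous (a : Λ) : Continuous (F a) := hFc.comp (Continuous.prodMk_right a)
  refine tendsto_of_tendsto_of_tendsto_of_le_of_le tendsto_const_nhds
    (hS.tendsto_eLpNorm_comp_partialField_sub hμ hFc hr hF ha hq1 hq) (fun _ => zero_le) fun n => ?_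
  exact eLpNorm_integral_sub_le (g := fun z => F (a n) (partialField n z))
    (h := fun z => F a' (S z)) (memLp_comp_partialField hμ (continuous _) hr (hF _) hq1 hq n)
    (memLp_comp hS.memLp (continuous _) hr (hF _) hq1 hq) hq1 hq

end Growth

variable {Φ : ℝ → ℝ} {A r : ℝ}

theorem memLp_deriv_comp (hS : IsField μ S) (hμ : IsCenteredGaussian Q μ)
    (hΦ : IsC1OfGrowth Φ A r) (hq1 : 1 ≤ q) (hq : q ≠ ⊤) :
    MemLp (fun z => deriv Φ (S z)) q (μ.prod vol01) := by
  have := hμ.isGaussian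
  exact memLp_comp hS.memLp (hΦ.contDiff.continuous_deriv le_rfl) hΦ.pos hΦ.abs_deriv_le hq1 hq

theorem tendsto_eLpNorm_gradU_sub (hS : IsField μ S) (hμ : IsCenteredGaussian Q μ)
    (hΦ : IsC1OfGrowth Φ A r) {ε : ℕ → ℝ} (hε : Tendsto ε atTop (𝓝 0)) (hq2 : 2 ≤ q) (hq : q ≠ ⊤) :
    Tendsto (fun m =>
      eLpNorm (gradU (fun t => Φ (trunc (ε m) t)) (partialField m) - gradU Φ S) q μ)
      atTop (𝓝 0) := by
  have hq1 : 1 ≤ q := one_le_two.trans hq2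
  have deriv_lim := hS.tendsto_eLpNorm_comp_partialField_sub hμ hΦ.continuous_deriv_comp_trunc
    hΦ.pos (fun ε => (hΦ.comp_trunc ε).abs_deriv_le) hε hq1 hq
  simp only [trunc_zero] at deriv_lim
  have lim := ENNReal.Tendsto.const_mul (a := ‖(√2)⁻¹‖ₑ)
    (ENNReal.Tendsto.const_mul (a := ‖ofL2‖ₑ) deriv_lim (Or.inr enorm_ne_top))
    (Or.inr enorm_ne_top)
  rw [mul_zero, mul_zero] at lim
  refine tendsto_of_tendsto_of_tendsto_of_le_of_le tendsto_const_nhds lim (fun _ => zero_le)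
    fun m => eLpNorm_gradU_sub_le ?_ (hS.memLp_deriv_comp hμ hΦ hq1 hq) hq2 hq
  have hΦm := hΦ.comp_trunc (ε m)
  exact memLp_comp_partialField hμ (hΦm.contDiff.continuous_deriv le_rfl) hΦm.pos
    hΦm.abs_deriv_le hq1 hq m

theorem hasSobolevGrad (hS : IsField μ S) (hμ : IsCenteredGaussian Q μ)
    (hΦ : IsC1OfGrowth Φ A r) (hq2 : 2 ≤ q) (hq : q ≠ ⊤) :
    HasSobolevGrad μ f Qhalf q (fun x => ∫ ξ, Φ (S (x, ξ)) ∂vol01) (gradU Φ S) := by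
  have := hμ.isGaussian
  have hq1 : 1 ≤ q := one_le_two.trans hq2
  let ε (m : ℕ) : ℝ := 1 / (m + 1)
  have ε_lim : Tendsto ε atTop (𝓝 0) := tendsto_one_div_add_atTop_nhds_zero_nat
  have truncated_isC1b (m : ℕ) : IsC1b fun t => Φ (trunc (ε m) t) :=
    hΦ.isC1b_comp_trunc Nat.one_div_pos_of_nat
  have grad_memLp := memLp_gradU (hS.memLp_deriv_comp hμ hΦ hq1 hq) hq2 hq
  refine ⟨memLp_integral (memLp_comp hS.memLp hΦ.contDiff.continuous hΦ.pos hΦ.abs_apply_le hq1 hq)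
    hq1 hq, grad_memLp, fun m => Un (fun t => Φ (trunc (ε m) t)) m,
    fun m => isCylindrical_Un (truncated_isC1b m) m, ?_, ?_⟩
  · simpa only [trunc_zero] using hS.tendsto_eLpNorm_Un_sub hμ hΦ.continuous_comp_trunc hΦ.pos
      (fun ε => (hΦ.comp_trunc ε).abs_apply_le) ε_lim hq1 hq
  · simp only [Qhalf_gradient_Un (truncated_isC1b _)]
    refine tendsto_eLpNorm_P_comp_sub hq1 hq (fun m => ?_) grad_memLp
      (hS.tendsto_eLpNorm_gradU_sub hμ hΦ ε_lim hq2 hq)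
    have hΦm := hΦ.comp_trunc (ε m)
    exact (memLp_gradU (memLp_comp_partialField hμ (hΦm.contDiff.continuous_deriv le_rfl) hΦm.pos
      hΦm.abs_deriv_le hq1 hq m) hq2 hq).1

end IsField

namespace IsField

variable {μ : Measure H} {S : H × ℝ → ℝ} {Φ : ℝ → ℝ} {A r : ℝ}

theorem isPartialDeriv (hS : IsField μ S) (hμ : IsCenteredGaussian Q μ)
    (hΦ : IsC1OfGrowth Φ A r) {p : ℝ≥0∞} (hp1 : 1 ≤ p) {u : H → ℝ}
    (hu : HasSobolevGrad μ f Qhalf p u (gradU Φ S)) {k : ℕ} (hk : 1 ≤ k) :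
    IsPartialDeriv μ p u k fun x => ∫ ξ, deriv Φ (toFun x ξ) * fFun k ξ ∂vol01 := by
  refine ⟨⟨_, hu⟩, fun G hG => ?_⟩
  have eig_sqrt_pos : 0 < √(eig k) := Real.sqrt_pos.2 (eig_pos hk)
  filter_upwards [hG.ae_inner_eq hu hμ hp1 (fun x y => Qhalf_isPositive.1 x y) (norm_f hk)
      (Qhalf_f hk) eig_sqrt_pos (by rw [Real.sq_sqrt (eig_pos hk).le, Q_f hk]),
    hS.ae_toFun_eq hμ,
    ae_memLp_two_prodMk (hS.memLp_deriv_comp hμ hΦ one_le_two ENNReal.ofNat_ne_top) le_rfl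
      ENNReal.ofNat_ne_top] with x hGx hx hmem
  have integral_eq : ∫ ξ, deriv Φ (toFun x ξ) * fFun k ξ ∂vol01 =
      ∫ ξ, deriv Φ (S (x, ξ)) * fFun k ξ ∂vol01 :=
    integral_mul_congr_left (hx.fun_comp (deriv Φ)) _
  rw [hGx, inner_gradU hmem hk, integral_eq, inv_mul_cancel_left₀ eig_sqrt_pos.ne']

theorem ae_integrable_deriv_toFun (hS : IsField μ S) (hμ : IsCenteredGaussian Q μ)
    (hΦ : IsC1OfGrowth Φ A r) (k : ℕ) :
    ∀ᵐ x ∂μ, Integrable (fun ξ => deriv Φ (toFun x ξ) * fFun k ξ) vol01 := by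
  filter_upwards [hS.ae_toFun_eq hμ,
    ae_memLp_prodMk (hS.memLp_deriv_comp hμ hΦ le_rfl ENNReal.one_ne_top) ENNReal.one_ne_top]
    with x hx hmem
  exact (integrable_mul_continuous (memLp_one_iff_integrable.1 hmem) (continuous_fFun k)).congr
    ((hx.fun_comp (deriv Φ)).symm.mul .rfl)

end IsField

end CahnHilliard

open CahnHilliard in
theorem proposition6p4_general (μ : Measure H) (hμ : IsCenteredGaussian Q μ) {Φ : ℝ → ℝ}
    {C p₂ : ℝ} (hΦ : ContDiff ℝ 1 Φ) (hp₂ : 0 ≤ p₂)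
    (growth : ∀ t, |deriv Φ t| ≤ C * (1 + |t| ^ p₂)) :
    (∀ᵐ x ∂μ, U Φ p₂ x ≠ ⊤) ∧
    (∀ (n : ℕ) (x : H), U Φ p₂ (P n x) = (Un Φ n x : EReal)) ∧
    (∀ p : ℝ≥0∞, 1 ≤ p → p ≠ ⊤ →
      MemW μ p (fun x => (U Φ p₂ x).toReal) ∧
      (∀ n : ℕ, MemLp (Un Φ n) p μ) ∧
      Tendsto (fun n : ℕ => eLpNorm (fun x => Un Φ n x - (U Φ p₂ x).toReal) p μ) atTop (𝓝 0) ∧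
      ∀ k : ℕ, 1 ≤ k → IsPartialDeriv μ p (fun x => (U Φ p₂ x).toReal) k
        (fun x => ∫ ξ, deriv Φ (toFun x ξ) * fFun k ξ ∂vol01)) ∧
    (∀ k : ℕ, 1 ≤ k → ∀ᵐ x ∂μ,
      Integrable (fun ξ => deriv Φ (toFun x ξ) * fFun k ξ) vol01) := by
  have := hμ.isGaussian
  have hΦ' := IsC1OfGrowth.of_abs_deriv_le hΦ hp₂ growth
  obtain ⟨S, hS⟩ := exists_isField hμ
  have U_eq := hS.ae_U_eq hμ Φ hp₂
  have integral_eq : (fun x => ∫ ξ, Φ (S (x, ξ)) ∂vol01) =ᵐ[μ] fun x => (U Φ p₂ x).toReal := by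
    filter_upwards [U_eq] with x hx using by rw [hx, EReal.toReal_coe]
  refine ⟨?_, U_P Φ hp₂, fun p hp1 hp => ?_, fun k _ => hS.ae_integrable_deriv_toFun hμ hΦ' k⟩
  · filter_upwards [U_eq] with x hx using hx ▸ EReal.coe_ne_top _
  have grad : HasSobolevGrad μ f Qhalf p (fun x => (U Φ p₂ x).toReal) (gradU Φ S) :=
    ((hS.hasSobolevGrad hμ hΦ' (le_max_right p 2) (max_ne_top hp ENNReal.ofNat_ne_top)).mono
      (le_max_left p 2)).congr integral_eq
  have Un_tendsto := hS.tendsto_eLpNorm_Un_sub hμ (F := fun _ : Unit => Φ) (a := fun _ => ())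
    (hΦ.continuous.comp continuous_snd) hΦ'.pos (fun _ => hΦ'.abs_apply_le) tendsto_const_nhds
    hp1 hp
  refine ⟨⟨_, grad⟩, memLp_Un hμ hΦ.continuous hΦ'.pos hΦ'.abs_apply_le hp1 hp, ?_,
    fun k hk => hS.isPartialDeriv hμ hΦ' hp1 grad hk⟩
  refine Un_tendsto.congr fun n => eLpNorm_congr_ae ?_
  filter_upwards [integral_eq] with x hx using by rw [hx]

theorem proposition6p4 (μ : Measure CahnHilliard.H)
    (hμ : CahnHilliard.IsCenteredGaussian CahnHilliard.Q μ)
    (Φ : ℝ → ℝ) (C p₂ : ℝ) (hΦ : CahnHilliard.IsPotential Φ C p₂) :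
    -- `U` is finite almost everywhere, and `U ∘ P_n = U_n` is finite everywhere
    (∀ᵐ x ∂μ, CahnHilliard.U Φ p₂ x ≠ ⊤) ∧
    (∀ (n : ℕ) (x : CahnHilliard.H),
      CahnHilliard.U Φ p₂ (CahnHilliard.P n x) = (CahnHilliard.Un Φ n x : EReal)) ∧
    (∀ p : ENNReal, 1 ≤ p → p ≠ ⊤ →
      CahnHilliard.MemW μ p (fun x => (CahnHilliard.U Φ p₂ x).toReal) ∧
      (∀ n : ℕ, MemLp (CahnHilliard.Un Φ n) p μ) ∧
      Tendsto (fun n : ℕ =>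
          eLpNorm (fun x => CahnHilliard.Un Φ n x - (CahnHilliard.U Φ p₂ x).toReal) p μ)
        atTop (𝓝 0) ∧
      ∀ k : ℕ, 1 ≤ k →
        CahnHilliard.IsPartialDeriv μ p (fun x => (CahnHilliard.U Φ p₂ x).toReal) k
          (fun x => ∫ ξ, deriv Φ (CahnHilliard.toFun x ξ) * CahnHilliard.fFun k ξ
            ∂CahnHilliard.vol01)) ∧
    (∀ k : ℕ, 1 ≤ k → ∀ᵐ x ∂μ,
      Integrable (fun ξ => deriv Φ (CahnHilliard.toFun x ξ) * CahnHilliard.fFun k ξ)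
        CahnHilliard.vol01) :=
  proposition6p4_general μ hμ hΦ.contDiff (zero_le_one.trans hΦ.one_le) hΦ.growth
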